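/- Let $G=(V,E)$ be a finite graph (parallel edges and loops are allowed), let $X\subseteq V$ be a set of vertices (the pins), and let $\tilde p_X:X\to\mathbb P^2$ be an injective map into the real projective plane. For $F\subseteq E$ let $V(F)$ be the set of vertices incident to an edge of $F$, and put \[ f_X(F)=\begin{cases}0&\text{if }|X\cap V(F)|=0,\\ 2&\text{if }|X\cap V(F)|=1,\\ 3&\text{otherwise.}\end{cases} \] A \emph{joint configuration} is an injective map $\tilde p:V\to\mathbb P^2$, $v\mapsto[\tilde p_v]$ with $\tilde p_v\in\mathbb R^3\setminus\{0\}$. An \emph{infinitesimal motion} of the pinned bar-joint framework $(G,X,\tilde p)$ is a map $m:V\to\mathbb R^3$ with $\det(m(u)-m(v),\tilde p_u,\tilde p_v)=0$ for every edge $uv\in E$ and $\det(m(v),\tilde p_v,q)=0$ for all $v\in X$ and $q\in\mathbb R^3$. (Here $\det(m,a,b)$ is the pairing of $m$ with the Plücker coordinate $a\wedge b$ of the line through $[a]$ and $[b]$, so each vertex is regarded as a rigid body, each edge as a bar through its two joints, and pinning a joint means fixing it by all the lines through it.) The framework is \emph{infinitesimally rigid} if every infinitesimal motion is a linear combination of the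 trivial danglings $m_v$ $(v\in V)$, where $m_v(v)=\tilde p_v$ and $m_v(u)=0$ for $u\ne v$. It is \emph{minimally infinitesimally rigid} if it is infinitesimally rigid and the removal of any edge results in a framework that is not infinitesimally rigid. Then there is a joint configuration $\tilde p:V\to\mathbb P^2$ extending $\tilde p_X$ such that $(G,X,\tilde p)$ is minimally infinitesimally rigid if and only if \begin{itemize} \item $|E|=2|V\setminus X|$, and \item $|F|\le 2|V(F)\setminus X|-3+f_X(F)$ for every nonempty $F\subseteq E$. \end{itemize} -/

import Mathlib

open scoped Matrix Graph LinearAlgebra.Projectivization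

/-- The real projective plane, the points of which are the lines through the origin of `ℝ³`. -/
abbrev RealProjectivePlane : Type := ℙ ℝ (Fin 3 → ℝ)

/-- Plücker coordinates of the bar through the points `[a]` and `[b]`: the wedge `a ∧ b`, written in
`ℝ³` through the Hodge star `⋆(a ∧ b) = a ⨯₃ b`. Hence `m ⬝ᵥ barCoord a b = det (m, a, b)` is the
pairing `⟨m, a ∧ b⟩` of `⋀¹ ℝ³` with `⋀² ℝ³`. -/
def barCoord (a b : Fin 3 → ℝ) : Fin 3 → ℝ := a ⨯₃ b

section Pinned

variable {α β : Type*}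

/-- The set `V(F)` of the vertices of `G` that are incident to an edge of `F`. -/
def Graph.incidentVertices (G : Graph α β) (F : Set β) : Set α := {v | ∃ e ∈ F, G.Inc e v}

/-- An infinitesimal motion of the pinned bar-joint framework `(G, X, p)` in the projective plane.
Every vertex `v` is a body with an infinitesimal motion `m v ∈ ⋀¹ ℝ³ = ℝ³`. A bar constraint does not
depend on the homogeneous coordinates chosen for its ends. Pinning a body at a point means that each
line through this point is a bar between the body and the fixed external environment. -/
structure IsPinnedMotion (G : Graph α β) (X : Set α) (p : V(G) → RealProjectivePlane)
    (m : V(G) → (Fin 3 → ℝ)) : Prop where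
  bar : ∀ (e : β) (u v : V(G)), G.IsLink e u v → (m u - m v) ⬝ᵥ barCoord (p u).rep (p v).rep = 0
  pin : ∀ v : V(G), (v : α) ∈ X → ∀ q : Fin 3 → ℝ, m v ⬝ᵥ barCoord (p v).rep q = 0

open Classical in
/-- The trivial dangling around `v`: the body `v` (a joint, hence zero-dimensional) rotates around its
own position, and the other bodies rest. -/
noncomputable def trivialDangling {V : Type*} (p : V → RealProjectivePlane) (v : V) :
    V → (Fin 3 → ℝ) :=
  Pi.single v (p v).rep

/-- `(G, X, p)` is infinitesimally rigid: every infinitesimal motion is a linear combination of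
trivial danglings, that is, no joint moves. -/
def IsPinnedInfRigid (G : Graph α β) (X : Set α) (p : V(G) → RealProjectivePlane) : Prop :=
  ∀ m : V(G) → (Fin 3 → ℝ), IsPinnedMotion G X p m →
    m ∈ Submodule.span ℝ (Set.range (trivialDangling p))

/-- `(G, X, p)` is infinitesimally rigid, but not after the removal of any bar. -/
def IsMinPinnedInfRigid (G : Graph α β) (X : Set α) (p : V(G) → RealProjectivePlane) : Prop :=
  IsPinnedInfRigid G X p ∧ ∀ e ∈ E(G), ¬ IsPinnedInfRigid (G.deleteEdges {e}) X p

open Classical in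
/-- The function `f_X`: it is `0`, `2` or `3` if `V(F)` has no, one or at least two pins. -/
noncomputable def pinBonus (G : Graph α β) (X : Set α) (F : Set β) : ℤ :=
  if (X ∩ G.incidentVertices F).ncard = 0 then 0
  else if (X ∩ G.incidentVertices F).ncard = 1 then 2
  else 3

end Pinned

/-! A dangling at a joint does not affect any bar, so pins may be taken to rest. Everything then
depends on `barMap`, the linear map from the motions of the free joints, a space of dimension
3|V∖X|, to ℝ^E.

Necessity. Rigidity confines the kernel to the danglings, of dimension |V∖X|, so |E| ≥ 2|V∖X|.
Minimality gives, for each bar, a motion violating that bar alone, so `barMap` is surjective, and it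
stays so for F and the free joints of V(F). There the kernel contains the danglings and the space K
of rigid motions of the plane that keep the pins of V(F). Since dim K = 3 - f_X(F), the sparsity
bound follows (`card_add_finrank_le_of_surjective_barMap`).

Sufficiency is an induction in the style of Laman's theorem. Sparsity excludes loops and parallel
edges, and says that the graph satisfies Laman's count after a minimally rigid graph is added on the
pins. A tight graph with a free vertex has one of degree 2 or 3. Deleting it, and in the second case
joining two of its neighbours by an edge, keeps the counts (`PinnedSparse.exists_reduction`).
Conversely, a vertex of degree 2 can be put anywhere off the line of its neighbours. A vertex of
degree 3 is first put on the line of the edge it replaces, where rigidity is evident, and then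
perturbed, since rigidity is an open condition. The given pins may be collinear, so the three
neighbours must not all be pins; this holds because the set of all pins is itself tight. -/

/-! ### Cross product identities for joints and bars. -/

section CrossProduct

variable {m a b c v y : Fin 3 → ℝ}

lemma dotProduct_cross_eq_zero_left (h : m ⨯₃ a = 0) (b : Fin 3 → ℝ) : m ⬝ᵥ (a ⨯₃ b) = 0 := by
  rw [triple_product_permutation, triple_product_permutation, h, dotProduct_zero]

lemma dotProduct_cross_eq_zero_right (h : m ⨯₃ b = 0) (a : Fin 3 → ℝ) : m ⬝ᵥ (a ⨯₃ b) = 0 := by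
  rw [← cross_anticomm, dotProduct_neg, dotProduct_cross_eq_zero_left h, neg_zero]

/-- Cramer's rule in the plane orthogonal to v, where m × v, v × a and v × b all lie: two bars at v
in different directions determine m × v, the velocity of the joint. -/
lemma triple_smul_cross (m v a b : Fin 3 → ℝ) :
    (v ⬝ᵥ (a ⨯₃ b)) • (m ⨯₃ v) =
      (m ⬝ᵥ (v ⨯₃ b)) • (v ⨯₃ a) - (m ⬝ᵥ (v ⨯₃ a)) • (v ⨯₃ b) := by
  ext i
  simp only [cross_apply, Matrix.vec3_dotProduct, Pi.smul_apply, Pi.sub_apply, smul_eq_mul,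
    Matrix.cons_val]
  fin_cases i <;> dsimp only [Matrix.cons_val, Fin.zero_eta, Fin.mk_one, Fin.reduceFinMk] <;> ring

lemma cross_eq_zero_of_two_bars (hv : v ⬝ᵥ (a ⨯₃ b) ≠ 0) (ha : m ⬝ᵥ (v ⨯₃ a) = 0)
    (hb : m ⬝ᵥ (v ⨯₃ b) = 0) : m ⨯₃ v = 0 := by
  have h := triple_smul_cross m v a b
  rw [ha, hb, zero_smul, zero_smul, sub_zero] at h
  exact (smul_eq_zero.1 h).resolve_left hv

lemma exists_smul_of_cross_eq_zero (hv : v ≠ 0) (h : m ⨯₃ v = 0) : ∃ t : ℝ, m = t • v := by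
  by_contra! hcon
  have h1 : LinearIndependent ℝ ![v, m] :=
    (LinearIndependent.pair_iff' hv).2 fun t ht => hcon t ht.symm
  apply crossProduct_ne_zero_iff_linearIndependent.2 h1
  rw [← cross_anticomm, h, neg_zero]

lemma eq_zero_of_cross_of_dotProduct (hv : v ≠ 0) (h : m ⨯₃ v = 0) (h' : m ⬝ᵥ v = 0) : m = 0 := by
  obtain ⟨t, rfl⟩ := exists_smul_of_cross_eq_zero hv h
  rw [smul_dotProduct, smul_eq_mul, mul_eq_zero, dotProduct_self_eq_zero] at h'
  rw [h'.resolve_right hv, zero_smul]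

/-- Danglings at the ends of a bar do not contribute to its constraint; this permits every
normalisation of motions below. -/
lemma bar_eq_of_cross_eq_zero {m' n' w : Fin 3 → ℝ} (hm : m' ⨯₃ v = 0) (hn : n' ⨯₃ w = 0)
    (m n : Fin 3 → ℝ) : (m + m' - (n + n')) ⬝ᵥ (v ⨯₃ w) = (m - n) ⬝ᵥ (v ⨯₃ w) := by
  have h1 := dotProduct_cross_eq_zero_left hm w
  have h2 := dotProduct_cross_eq_zero_right hn v
  simp only [sub_dotProduct, add_dotProduct, h1, h2, add_zero]

/-- An open set is not covered by finitely many planes through the origin. -/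
lemma exists_mem_nhds_forall_dotProduct_ne_zero {ι n : Type*} [Fintype n] (N : Finset ι)
    (f : ι → n → ℝ) (hf : ∀ i ∈ N, f i ≠ 0) {O : Set (n → ℝ)} {y : n → ℝ} (hO : O ∈ nhds y) :
    ∃ z ∈ O, ∀ i ∈ N, z ⬝ᵥ f i ≠ 0 := by
  classical
  have h1 : ∀ i ∈ N, IsOpen {z : n → ℝ | z ⬝ᵥ f i ≠ 0} ∧ Dense {z : n → ℝ | z ⬝ᵥ f i ≠ 0} := by
    intro i hi
    have hop : IsOpen {z : n → ℝ | z ⬝ᵥ f i ≠ 0} :=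
      isOpen_ne_fun (by unfold dotProduct; fun_prop) continuous_const
    refine ⟨hop, ?_⟩
    let K : Submodule ℝ (n → ℝ) :=
      { carrier := {z | z ⬝ᵥ f i = 0}
        add_mem' := fun {a b} ha hb => by
          simp only [Set.mem_ofPred_eq] at *
          rw [add_dotProduct, ha, hb, add_zero]
        zero_mem' := zero_dotProduct _
        smul_mem' := fun c x hx => by
          simp only [Set.mem_ofPred_eq] at *
          rw [smul_dotProduct, hx, smul_zero] }
    have hK : interior (K : Set (n → ℝ)) = ∅ := by
      by_contra hne
      have htop := K.eq_top_of_nonempty_interior' (Set.nonempty_iff_ne_empty.2 hne)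
      -- A nonzero `f i` is not orthogonal to itself, so the hyperplane is a proper subspace.
      have : f i ∈ K := htop ▸ Submodule.mem_top
      exact hf i hi (dotProduct_self_eq_zero.1 this)
    exact interior_eq_empty_iff_dense_compl.1 hK
  have h2 : IsOpen {z : n → ℝ | ∀ i ∈ N, z ⬝ᵥ f i ≠ 0} ∧
      Dense {z : n → ℝ | ∀ i ∈ N, z ⬝ᵥ f i ≠ 0} := by
    induction N using Finset.induction_on with
    | empty => simp
    | insert i N hi ih =>
      have h3 := ih (fun j hj => hf j (Finset.mem_insert_of_mem hj))
        (fun j hj => h1 j (Finset.mem_insert_of_mem hj))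
      have h4 := h1 i (Finset.mem_insert_self i N)
      have h5 : {z : n → ℝ | ∀ j ∈ insert i N, z ⬝ᵥ f j ≠ 0} =
          {z | z ⬝ᵥ f i ≠ 0} ∩ {z | ∀ j ∈ N, z ⬝ᵥ f j ≠ 0} := by
        ext z
        simp
      rw [h5]
      exact ⟨h4.1.inter h3.1, h4.2.inter_of_isOpen_left h3.2 h4.1⟩
  obtain ⟨z, hz, hz'⟩ := h2.2.inter_nhds_nonempty hO
  exact ⟨z, hz', hz⟩

end CrossProduct

/-! ### Infinitesimal rigidity: the two extension moves and openness. -/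

section JointsFixed

variable {V : Type*} {H H' : SimpleGraph V} {X S : Set V} {q : V → Fin 3 → ℝ} {v a b c : V}

/-- Infinitesimal rigidity of the framework with graph `H`, pins `X` and homogeneous coordinates `q`:
an infinitesimal motion moves no joint in `S`. -/
def JointsFixed (H : SimpleGraph V) (X S : Set V) (q : V → Fin 3 → ℝ) : Prop :=
  ∀ m : V → Fin 3 → ℝ, (∀ x y, H.Adj x y → (m x - m y) ⬝ᵥ (q x ⨯₃ q y) = 0) →
    (∀ x ∈ X, m x ⨯₃ q x = 0) → ∀ v ∈ S, m v ⨯₃ q v = 0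

lemma JointsFixed.congr {q' : V → Fin 3 → ℝ} (h : JointsFixed H X S q)
    (hH : ∀ x y, H.Adj x y → x ∈ S) (hXS : X ⊆ S) (hq : ∀ x ∈ S, q x = q' x) :
    JointsFixed H X S q' := by
  intro m h1 h2 v hv
  rw [← hq v hv]
  refine h m (fun x y hxy => ?_) (fun x hx => ?_) v hv
  · rw [hq x (hH _ _ hxy), hq y (hH _ _ hxy.symm)]
    exact h1 x y hxy
  · rw [hq x (hXS hx)]
    exact h2 x hx

/-- A joint attached by two bars to fixed joints, not on a line with them, is fixed. -/
lemma JointsFixed.insert_of_two_bars (h : JointsFixed H' X S q) (hH : H' ≤ H) (ha : a ∈ S)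
    (hb : b ∈ S) (hva : H.Adj v a) (hvb : H.Adj v b) (hdet : q v ⬝ᵥ (q a ⨯₃ q b) ≠ 0) :
    JointsFixed H X (insert v S) q := by
  intro m h1 h2
  have h3 := h m (fun x y hxy => h1 x y (hH hxy)) h2
  have key : ∀ c ∈ S, H.Adj v c → m v ⬝ᵥ (q v ⨯₃ q c) = 0 := by
    intro c hc hvc
    have h4 := h1 v c hvc
    rwa [sub_dotProduct, dotProduct_cross_eq_zero_right (h3 c hc), sub_zero] at h4
  rintro x (rfl | hx)
  · exact cross_eq_zero_of_two_bars hdet (key a ha hva) (key b hb hvb)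
  · exact h3 x hx

/-- A bar between two joints can be replaced by a joint on the line of the bar with bars to
both joints and to a third fixed joint off this line. -/
lemma JointsFixed.insert_of_subdivide (h : JointsFixed H' X S q)
    (hH : ∀ x y, H'.Adj x y → H.Adj x y ∨ (x = a ∧ y = b) ∨ (x = b ∧ y = a)) (ha : a ∈ S)
    (hc : c ∈ S) (hva : H.Adj v a) (hvb : H.Adj v b) (hvc : H.Adj v c)
    (hdet : q a ⬝ᵥ (q b ⨯₃ q c) ≠ 0) (hv : q v = q a + q b) :
    JointsFixed H X (insert v S) q := by
  intro m h1 h2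
  have hva' := h1 v a hva
  have hvb' := h1 v b hvb
  have hvc' := h1 v c hvc
  have e1 : q v ⨯₃ q a = -(q a ⨯₃ q b) := by
    rw [hv, map_add, LinearMap.add_apply, cross_self, zero_add, cross_anticomm]
  have e2 : q v ⨯₃ q b = q a ⨯₃ q b := by
    rw [hv, map_add, LinearMap.add_apply, cross_self, add_zero]
  rw [e1, dotProduct_neg, neg_eq_zero, sub_dotProduct, sub_eq_zero] at hva'
  rw [e2, sub_dotProduct, sub_eq_zero] at hvb'
  -- The bars va and vb lie on the line ab, so both read the same component of `m v`. Hence `m a`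
  -- and `m b` agree in it, which is the constraint of the removed bar.
  have hab : (m a - m b) ⬝ᵥ (q a ⨯₃ q b) = 0 := by
    rw [sub_dotProduct, ← hva', ← hvb', sub_self]
  have h3 : ∀ x ∈ S, m x ⨯₃ q x = 0 := by
    refine h m (fun x y hxy => ?_) h2
    rcases hH x y hxy with hxy | ⟨rfl, rfl⟩ | ⟨rfl, rfl⟩
    · exact h1 x y hxy
    · exact hab
    · rw [← cross_anticomm, dotProduct_neg, ← neg_dotProduct, neg_sub]
      exact hab
  rintro x (rfl | hx)
  · refine cross_eq_zero_of_two_bars (a := q a) (b := q c) ?_ ?_ ?_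
    · rw [hv, add_dotProduct, dot_self_cross, zero_add]
      intro h4
      apply hdet
      rw [triple_product_permutation, ← cross_anticomm, dotProduct_neg, h4, neg_zero]
    · rw [e1, dotProduct_neg, hva', dotProduct_cross_eq_zero_left (h3 a ha), neg_zero]
    · rwa [sub_dotProduct, dotProduct_cross_eq_zero_right (h3 c hc), sub_zero] at hvc'
  · exact h3 x hx

open scoped Classical in
/-- The bar constraints of free joints, together with equations that leave no trivial dangling. -/
noncomputable def normalizedConstraints (H : SimpleGraph V) (T : Set V) (q : V → Fin 3 → ℝ) :
    (V → Fin 3 → ℝ) →ₗ[ℝ] (V × V → ℝ) × (V → Fin 3 → ℝ) × (V → ℝ) where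
  toFun m := (fun e => if H.Adj e.1 e.2 then (m e.1 - m e.2) ⬝ᵥ (q e.1 ⨯₃ q e.2) else 0,
    fun x => if x ∈ T then 0 else m x, fun x => m x ⬝ᵥ q x)
  map_add' m n := by
    refine Prod.ext (funext fun e => ?_) (Prod.ext (funext fun x => ?_) (funext fun x => ?_))
    · dsimp only [Pi.add_apply, Prod.fst_add]
      split_ifs
      · simp only [sub_dotProduct, add_dotProduct]; ring
      · simp
    · dsimp only [Pi.add_apply, Prod.fst_add, Prod.snd_add]
      split_ifs <;> simp
    · simp [add_dotProduct]
  map_smul' t m := by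
    refine Prod.ext (funext fun e => ?_) (Prod.ext (funext fun x => ?_) (funext fun x => ?_))
    · dsimp only [Pi.smul_apply, Prod.smul_fst, RingHom.id_apply]
      split_ifs
      · simp only [sub_dotProduct, smul_dotProduct, smul_eq_mul]; ring
      · simp
    · dsimp only [Pi.smul_apply, Prod.smul_fst, Prod.smul_snd, RingHom.id_apply]
      split_ifs <;> simp
    · simp [smul_dotProduct]

/-- With the converse below, this turns rigidity into injectivity of a linear map that depends
continuously on `q`. The last group of equations kills danglings: a vector both parallel and
orthogonal to `q x ≠ 0` is zero. -/
lemma JointsFixed.injective_normalizedConstraints (h : JointsFixed H X S q)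
    (hq : ∀ x ∈ S, q x ≠ 0) : Function.Injective (normalizedConstraints H (S \ X) q) := by
  rw [← LinearMap.ker_eq_bot, LinearMap.ker_eq_bot']
  intro m hm
  have h1 := congrArg Prod.fst hm
  have h2 := congrArg (fun t => t.2.1) hm
  have h3 := congrArg (fun t => t.2.2) hm
  simp only [normalizedConstraints, LinearMap.coe_mk, AddHom.coe_mk, Prod.fst_zero,
    Prod.snd_zero] at h1 h2 h3
  have h4 : ∀ x ∉ S \ X, m x = 0 := fun x hx => by simpa [if_neg hx] using congrFun h2 x
  have h5 := h m (fun x y hxy => by simpa [hxy] using congrFun h1 (x, y))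
    (fun x hx => by rw [h4 x fun h => h.2 hx]; simp)
  ext1 x
  by_cases hx : x ∈ S
  · exact eq_zero_of_cross_of_dotProduct (hq x hx) (h5 x hx) (congrFun h3 x)
  · exact h4 x fun h => hx h.1

lemma JointsFixed.of_injective_normalizedConstraints (hHS : ∀ x y, H.Adj x y → x ∈ S)
    (h : Function.Injective (normalizedConstraints H (S \ X) q)) : JointsFixed H X S q := by
  classical
  rw [← LinearMap.ker_eq_bot, LinearMap.ker_eq_bot'] at h
  intro m h1 h2
  -- Remove the dangling part at each free joint by orthogonal projection, and let all other
  -- vertices rest.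
  let n : V → Fin 3 → ℝ := fun x =>
    if x ∈ S \ X then m x - ((m x ⬝ᵥ q x) / (q x ⬝ᵥ q x)) • q x else 0
  have hd : ∀ x ∈ S, (m x - n x) ⨯₃ q x = 0 := by
    intro x hx
    by_cases hxT : x ∈ S \ X
    · simp only [n, if_pos hxT, sub_sub_cancel, map_smul, LinearMap.smul_apply, cross_self,
        smul_zero]
    · simp only [n, if_neg hxT, sub_zero]
      exact h2 x (by_contra fun hxX => hxT ⟨hx, hxX⟩)
  have hn : n = 0 := by
    apply h
    refine Prod.ext (funext fun e => ?_) (Prod.ext (funext fun x => ?_) (funext fun x => ?_))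
    · simp only [normalizedConstraints, LinearMap.coe_mk, AddHom.coe_mk, Prod.fst_zero,
        Pi.zero_apply]
      split_ifs with he
      · have h3 := bar_eq_of_cross_eq_zero (hd _ (hHS _ _ he)) (hd _ (hHS _ _ he.symm))
          (n e.1) (n e.2)
        rw [← h3, add_sub_cancel, add_sub_cancel, h1 _ _ he]
      · rfl
    · simp only [normalizedConstraints, LinearMap.coe_mk, AddHom.coe_mk]
      split_ifs with hx
      · rfl
      · exact if_neg hx
    · simp only [normalizedConstraints, LinearMap.coe_mk, AddHom.coe_mk, n]
      split_ifs
      -- If `q x = 0`, the quotient in `n` is 0 / 0 = 0, and the equation at `x` is void.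
      · by_cases hq : q x = 0
        · simp [hq]
        · have : q x ⬝ᵥ q x ≠ 0 := fun h => hq (dotProduct_self_eq_zero.1 h)
          simp only [sub_dotProduct, smul_dotProduct, smul_eq_mul]
          field_simp
          simp
      · simp
  intro x hx
  have := hd x hx
  rwa [hn, Pi.zero_apply, sub_zero] at this

/-- Infinitesimal rigidity is an open condition on the joints. -/
lemma JointsFixed.eventually [Finite V] (h : JointsFixed H X S q)
    (hHS : ∀ x y, H.Adj x y → x ∈ S) (hq : ∀ x ∈ S, q x ≠ 0) :
    ∀ᶠ q' in nhds q, JointsFixed H X S q' := by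
  classical
  have := Fintype.ofFinite V
  let B := Pi.basis fun _ : V => Pi.basisFun ℝ (Fin 3)
  -- Injectivity means that a fixed basis has linearly independent images, and linear independence
  -- of a finite family is an open condition.
  have hB : ∀ q' : V → Fin 3 → ℝ,
      LinearIndependent ℝ (fun i => normalizedConstraints H (S \ X) q' (B i)) ↔
        Function.Injective (normalizedConstraints H (S \ X) q') := by
    intro q'
    rw [← LinearMap.ker_eq_bot]
    constructor
    · intro hli
      exact LinearMap.ker_eq_bot.2 (LinearMap.injective_of_linearIndependent B.span_eq hli)
    · intro hk
      exact B.linearIndependent.map' _ hk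
  have hcont : Continuous fun q' : V → Fin 3 → ℝ =>
      fun i => normalizedConstraints H (S \ X) q' (B i) := by
    refine continuous_pi fun i => ?_
    simp only [normalizedConstraints, LinearMap.coe_mk, AddHom.coe_mk]
    refine Continuous.prodMk (continuous_pi fun e => ?_) (Continuous.prodMk continuous_const
      (continuous_pi fun x => ?_))
    · split_ifs
      · simp only [cross_apply, Matrix.vec3_dotProduct]
        simp
        fun_prop
      · exact continuous_const
    · simp only [Matrix.vec3_dotProduct]
      fun_prop
  have hev := hcont.continuousAt.eventually
    (LinearIndependent.eventually ((hB q).2 (h.injective_normalizedConstraints hq)))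
  filter_upwards [hev] with q' hq'
  exact .of_injective_normalizedConstraints hHS ((hB q').1 hq')

end JointsFixed

/-! ### Laman counts with pins, and the reduction of tight graphs. -/

section Sparsity

open Finset
open scoped Classical

variable {V : Type*}

/-- The number of ordered pairs of adjacent vertices in `U`, twice the number of induced edges. -/
noncomputable def adjPairs (H : SimpleGraph V) (U : Finset V) : ℕ := (H.interedges U U).card

/-- The number of neighbours of `v` in `U`. -/
noncomputable def degreeIn (H : SimpleGraph V) (v : V) (U : Finset V) : ℕ := {x ∈ U | H.Adj v x}.card

/-- The graph `H` with all edges at `v` removed. -/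
def isolateVertex (H : SimpleGraph V) (v : V) : SimpleGraph V where
  Adj x y := H.Adj x y ∧ x ≠ v ∧ y ≠ v
  symm := ⟨fun _ _ h => ⟨h.1.symm, h.2.2, h.2.1⟩⟩
  loopless := ⟨fun _ h => h.1.ne rfl⟩

variable {H H' : SimpleGraph V} {X S U W : Finset V} {v a b c : V}

lemma adjPairs_eq_sum (H : SimpleGraph V) (U : Finset V) :
    adjPairs H U = ∑ x ∈ U, degreeIn H x U := by
  unfold adjPairs degreeIn SimpleGraph.interedges Rel.interedges
  rw [Finset.card_filter, Finset.sum_product]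
  exact sum_congr rfl fun x _ => (Finset.card_filter _ _).symm

lemma sum_degreeIn_comm (H : SimpleGraph V) (U W : Finset V) :
    ∑ x ∈ U, degreeIn H x W = ∑ x ∈ W, degreeIn H x U := by
  unfold degreeIn
  simp only [Finset.card_filter]
  rw [Finset.sum_comm]
  simp only [H.adj_comm]

lemma degreeIn_eq_zero (h : ∀ x ∈ U, ¬ H.Adj v x) : degreeIn H v U = 0 :=
  card_eq_zero.2 (filter_eq_empty_iff.2 h)

lemma adjPairs_mono (h : H' ≤ H) (U : Finset V) : adjPairs H' U ≤ adjPairs H U := by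
  apply card_le_card
  intro x
  simp only [SimpleGraph.interedges, Rel.mem_interedges_iff]
  exact fun hx => ⟨hx.1, hx.2.1, h hx.2.2⟩

lemma adjPairs_eq_zero (h : U.card ≤ 1) : adjPairs H U = 0 := by
  unfold adjPairs
  rw [card_eq_zero, eq_empty_iff_forall_notMem]
  intro x
  simp only [SimpleGraph.interedges, Rel.mem_interedges_iff]
  rintro ⟨h1, h2, h3⟩
  exact h3.ne (card_le_one.mp h _ h1 _ h2)

lemma isolateVertex_adj {x y : V} : (isolateVertex H v).Adj x y ↔ H.Adj x y ∧ x ≠ v ∧ y ≠ v :=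
  Iff.rfl

lemma isolateVertex_le (H : SimpleGraph V) (v : V) : isolateVertex H v ≤ H := fun _ _ h => h.1

lemma adjPairs_isolateVertex (h : v ∉ U) : adjPairs (isolateVertex H v) U = adjPairs H U := by
  unfold adjPairs
  congr 1
  ext ⟨x, y⟩
  simp only [SimpleGraph.interedges, Rel.mem_interedges_iff, isolateVertex_adj]
  constructor
  · tauto
  · rintro ⟨h1, h2, h3⟩
    exact ⟨h1, h2, h3, fun e => h (e ▸ h1), fun e => h (e ▸ h2)⟩

variable [DecidableEq V]

/-- Twice the number of edges that `U` induces after a minimally rigid graph has been added on the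
pins in `X`. -/
noncomputable def pinnedWeight (H : SimpleGraph V) (X U : Finset V) : ℕ :=
  adjPairs H U + (4 * (U ∩ X).card - 6)

/-- The Laman sparsity condition for a graph with pins. -/
def PinnedSparse (H : SimpleGraph V) (X : Finset V) : Prop :=
  ∀ U : Finset V, 2 ≤ U.card → pinnedWeight H X U + 6 ≤ 4 * U.card

lemma degreeIn_union (h : Disjoint U W) :
    degreeIn H v (U ∪ W) = degreeIn H v U + degreeIn H v W := by
  unfold degreeIn
  rw [filter_union, card_union_of_disjoint]
  exact disjoint_filter_filter h

lemma degreeIn_insert_self (H : SimpleGraph V) (v : V) (U : Finset V) :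
    degreeIn H v (insert v U) = degreeIn H v U := by
  unfold degreeIn
  rw [filter_insert, if_neg (H.irrefl)]

lemma adjPairs_insert (h : v ∉ U) :
    adjPairs H (insert v U) = adjPairs H U + 2 * degreeIn H v U := by
  have h1 : ∀ x, degreeIn H x (insert v U) = degreeIn H x {v} + degreeIn H x U := fun x => by
    rw [insert_eq, degreeIn_union (by simpa using h)]
  rw [adjPairs_eq_sum, sum_insert h, degreeIn_insert_self]
  simp only [h1, sum_add_distrib]
  rw [sum_degreeIn_comm, adjPairs_eq_sum]
  simp
  ring

lemma even_adjPairs (H : SimpleGraph V) (U : Finset V) : Even (adjPairs H U) := by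
  induction U using Finset.induction_on with
  | empty => simp [adjPairs_eq_sum]
  | insert v U h ih => rw [adjPairs_insert h]; exact ih.add (even_two_mul _)

lemma PinnedSparse.mono (hH : PinnedSparse H X) (h : H' ≤ H) : PinnedSparse H' X := by
  intro U hU
  have h1 := hH U hU
  have h2 := adjPairs_mono h U
  unfold pinnedWeight at *
  omega

lemma adjPairs_supermodular (H : SimpleGraph V) (U W : Finset V) :
    adjPairs H U + adjPairs H W ≤ adjPairs H (U ∪ W) + adjPairs H (U ∩ W) := by
  unfold adjPairs
  rw [← card_union_add_card_inter]
  refine add_le_add (card_le_card ?_) (card_le_card ?_) <;> intro x <;>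
    simp only [SimpleGraph.interedges, mem_union, mem_inter, Rel.mem_interedges_iff] <;> tauto

lemma card_inter_supermodular (X U W : Finset V) :
    (U ∩ X).card + (W ∩ X).card = ((U ∪ W) ∩ X).card + ((U ∩ W) ∩ X).card := by
  rw [← card_union_add_card_inter]
  congr 2 <;> ext <;> simp only [mem_union, mem_inter] <;> tauto

/-- The truncated pin term is convex in the number of pins; union and intersection have the same
total number of pins as U and W, spread further apart. -/
lemma pinnedWeight_supermodular (H : SimpleGraph V) (X U W : Finset V) :
    pinnedWeight H X U + pinnedWeight H X W ≤
      pinnedWeight H X (U ∪ W) + pinnedWeight H X (U ∩ W) := by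
  have h1 := adjPairs_supermodular H U W
  have h2 := card_inter_supermodular X U W
  have h3 : ((U ∩ W) ∩ X).card ≤ (U ∩ X).card :=
    card_le_card (inter_subset_inter_right inter_subset_left)
  have h4 : ((U ∩ W) ∩ X).card ≤ (W ∩ X).card :=
    card_le_card (inter_subset_inter_right inter_subset_right)
  unfold pinnedWeight
  omega

lemma adjPairs_union_three {U₁ U₂ U₃ : Finset V} (h₁₂ : (U₁ ∩ U₂).card ≤ 1)
    (h₁₃ : (U₁ ∩ U₃).card ≤ 1) (h₂₃ : (U₂ ∩ U₃).card ≤ 1) :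
    adjPairs H U₁ + adjPairs H U₂ + adjPairs H U₃ ≤ adjPairs H (U₁ ∪ U₂ ∪ U₃) := by
  have key : ∀ {A B : Finset V}, (A ∩ B).card ≤ 1 →
      Disjoint (H.interedges A A) (H.interedges B B) := by
    intro A B h
    rw [disjoint_left]
    intro x
    simp only [SimpleGraph.interedges, Rel.mem_interedges_iff]
    rintro ⟨h1, h2, h3⟩ ⟨h4, h5, -⟩
    exact h3.ne (card_le_one.mp h _ (mem_inter.2 ⟨h1, h4⟩) _ (mem_inter.2 ⟨h2, h5⟩))
  unfold adjPairs
  rw [← card_union_of_disjoint (key h₁₂),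
    ← card_union_of_disjoint (disjoint_union_left.2 ⟨key h₁₃, key h₂₃⟩)]
  apply card_le_card
  intro x
  simp only [SimpleGraph.interedges, mem_union, Rel.mem_interedges_iff]
  tauto

/-- Overlaps lose at most three pins, worth 12, while three pin terms subtract 18 in place of a
single 6. If a set has fewer than two pins its term is truncated, but then fewer pins can be lost.
-/
lemma pinnedWeight_union_three {U₁ U₂ U₃ : Finset V} (h₁₂ : (U₁ ∩ U₂).card ≤ 1)
    (h₁₃ : (U₁ ∩ U₃).card ≤ 1) (h₂₃ : (U₂ ∩ U₃).card ≤ 1) :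
    pinnedWeight H X U₁ + pinnedWeight H X U₂ + pinnedWeight H X U₃ ≤
      pinnedWeight H X (U₁ ∪ U₂ ∪ U₃) := by
  have h0 := adjPairs_union_three (H := H) h₁₂ h₁₃ h₂₃
  have h1 := card_inter_supermodular X U₁ U₂
  have h2 := card_inter_supermodular X (U₁ ∪ U₂) U₃
  have h3 : ((U₁ ∩ U₂) ∩ X).card ≤ 1 := (card_le_card inter_subset_left).trans h₁₂
  have h4 : (((U₁ ∪ U₂) ∩ U₃) ∩ X).card + (U₁ ∩ U₂ ∩ U₃ ∩ X).card =
      (U₁ ∩ U₃ ∩ X).card + (U₂ ∩ U₃ ∩ X).card := by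
    rw [← card_union_add_card_inter (U₁ ∩ U₃ ∩ X)]
    congr 2 <;> ext <;> simp only [mem_union, mem_inter] <;> tauto
  have key : ∀ {A B C : Finset V}, A ∪ B ⊆ C → A ∩ B = U₁ ∩ U₂ ∩ U₃ ∩ X →
      A.card + B.card ≤ C.card + (U₁ ∩ U₂ ∩ U₃ ∩ X).card := fun {A B C} h h' => by
    rw [← card_union_add_card_inter, h']
    exact Nat.add_le_add_right (card_le_card h) _
  -- The pins in the two overlaps of one set are bounded by the pins of that set; this matters when
  -- its pin term is truncated.
  have k1 : (U₁ ∩ U₂ ∩ X).card + (U₁ ∩ U₃ ∩ X).card ≤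
      (U₁ ∩ X).card + (U₁ ∩ U₂ ∩ U₃ ∩ X).card := by
    apply key <;> (try ext) <;> (try intro) <;> simp only [mem_union, mem_inter] <;> tauto
  have k2 : (U₁ ∩ U₂ ∩ X).card + (U₂ ∩ U₃ ∩ X).card ≤
      (U₂ ∩ X).card + (U₁ ∩ U₂ ∩ U₃ ∩ X).card := by
    apply key <;> (try ext) <;> (try intro) <;> simp only [mem_union, mem_inter] <;> tauto
  have k3 : (U₁ ∩ U₃ ∩ X).card + (U₂ ∩ U₃ ∩ X).card ≤
      (U₃ ∩ X).card + (U₁ ∩ U₂ ∩ U₃ ∩ X).card := by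
    apply key <;> (try ext) <;> (try intro) <;> simp only [mem_union, mem_inter] <;> tauto
  have h5 : ((U₁ ∩ U₃) ∩ X).card ≤ 1 := (card_le_card inter_subset_left).trans h₁₃
  have h6 : ((U₂ ∩ U₃) ∩ X).card ≤ 1 := (card_le_card inter_subset_left).trans h₂₃
  have i1 : ((U₁ ∩ U₂) ∩ X).card ≤ (U₁ ∩ X).card :=
    card_le_card (inter_subset_inter_right inter_subset_left)
  have i2 : ((U₁ ∩ U₂) ∩ X).card ≤ (U₂ ∩ X).card :=
    card_le_card (inter_subset_inter_right inter_subset_right)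
  have i3 : ((U₁ ∩ U₃) ∩ X).card ≤ (U₁ ∩ X).card :=
    card_le_card (inter_subset_inter_right inter_subset_left)
  have i4 : ((U₂ ∩ U₃) ∩ X).card ≤ (U₂ ∩ X).card :=
    card_le_card (inter_subset_inter_right inter_subset_left)
  have i5 : (((U₁ ∪ U₂) ∩ U₃) ∩ X).card ≤ (U₃ ∩ X).card :=
    card_le_card (inter_subset_inter_right inter_subset_right)
  unfold pinnedWeight
  omega

/-- Tight sets that share two vertices have a tight union. -/
lemma PinnedSparse.union_tight (hH : PinnedSparse H X) (hU : 4 * U.card ≤ pinnedWeight H X U + 6)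
    (hW : 4 * W.card ≤ pinnedWeight H X W + 6) (hUW : 2 ≤ (U ∩ W).card) :
    4 * (U ∪ W).card ≤ pinnedWeight H X (U ∪ W) + 6 := by
  have h1 := pinnedWeight_supermodular H X U W
  have h2 := hH _ hUW
  have h3 := card_union_add_card_inter U W
  omega

lemma three_le_degreeIn (hab : a ≠ b) (hac : a ≠ c) (hbc : b ≠ c) (ha : H.Adj v a) (hb : H.Adj v b)
    (hc : H.Adj v c) (haU : a ∈ U) (hbU : b ∈ U) (hcU : c ∈ U) : 3 ≤ degreeIn H v U := by
  have h : ({a, b, c} : Finset V).card = 3 := card_eq_three.2 ⟨a, b, c, hab, hac, hbc, rfl⟩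
  rw [← h]
  apply card_le_card
  intro x
  simp only [mem_insert, mem_singleton, mem_filter]
  rintro (rfl | rfl | rfl) <;> exact ⟨by assumption, by assumption⟩

/-- Adding `v` raises the doubled edge count by at least 6 but the bound by only 4, and leaves the
pin term alone. -/
lemma PinnedSparse.not_tight_of_three (hH : PinnedSparse H X) (hv : v ∉ X) (hvU : v ∉ U)
    (hab : a ≠ b) (hac : a ≠ c) (hbc : b ≠ c) (ha : H.Adj v a) (hb : H.Adj v b)
    (hc : H.Adj v c) (haU : a ∈ U) (hbU : b ∈ U) (hcU : c ∈ U) :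
    pinnedWeight H X U + 6 < 4 * U.card := by
  have h1 := three_le_degreeIn hab hac hbc ha hb hc haU hbU hcU
  have h2 := hH (insert v U) (by
    rw [card_insert_of_notMem hvU]
    have : 0 < U.card := card_pos.2 ⟨a, haU⟩
    omega)
  unfold pinnedWeight at *
  rw [card_insert_of_notMem hvU, adjPairs_insert hvU, insert_inter_of_notMem hv] at h2
  omega

/-- Two of the tight sets that share two vertices have a tight union; otherwise the sets meet
pairwise in at most one vertex, and the union of all three is tight. Either union contains a, b and
c, which `v` forbids. -/
lemma PinnedSparse.exists_not_tight_pair (hH : PinnedSparse H X) (hv : v ∉ X)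
    (hab : a ≠ b) (hac : a ≠ c) (hbc : b ≠ c) (ha : H.Adj v a) (hb : H.Adj v b) (hc : H.Adj v c)
    {U₁ U₂ U₃ : Finset V} (hv₁ : v ∉ U₁) (hv₂ : v ∉ U₂) (hv₃ : v ∉ U₃)
    (ha₁ : a ∈ U₁) (hb₁ : b ∈ U₁) (hb₂ : b ∈ U₂) (hc₂ : c ∈ U₂) (ha₃ : a ∈ U₃) (hc₃ : c ∈ U₃)
    (h₁ : 4 * U₁.card ≤ pinnedWeight H X U₁ + 6) (h₂ : 4 * U₂.card ≤ pinnedWeight H X U₂ + 6)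
    (h₃ : 4 * U₃.card ≤ pinnedWeight H X U₃ + 6) : False := by
  have contra : ∀ {U : Finset V}, v ∉ U → a ∈ U → b ∈ U → c ∈ U →
      4 * U.card ≤ pinnedWeight H X U + 6 → False := fun h i j k l =>
    absurd (hH.not_tight_of_three hv h hab hac hbc ha hb hc i j k) (by omega)
  have k₁₂ : (U₁ ∩ U₂).card ≤ 1 := by
    by_contra! h
    exact contra (by simp [hv₁, hv₂]) (mem_union_left _ ha₁) (mem_union_left _ hb₁)
      (mem_union_right _ hc₂) (hH.union_tight h₁ h₂ h)
  have k₁₃ : (U₁ ∩ U₃).card ≤ 1 := by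
    by_contra! h
    exact contra (by simp [hv₁, hv₃]) (mem_union_left _ ha₁) (mem_union_left _ hb₁)
      (mem_union_right _ hc₃) (hH.union_tight h₁ h₃ h)
  have k₂₃ : (U₂ ∩ U₃).card ≤ 1 := by
    by_contra! h
    exact contra (by simp [hv₂, hv₃]) (mem_union_right _ ha₃) (mem_union_left _ hb₂)
      (mem_union_left _ hc₂) (hH.union_tight h₂ h₃ h)
  refine contra (U := U₁ ∪ U₂ ∪ U₃) (by simp [hv₁, hv₂, hv₃]) (by simp [ha₁]) (by simp [hb₁])
    (by simp [hc₂]) ?_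
  have h4 := pinnedWeight_union_three (H := H) (X := X) k₁₂ k₁₃ k₂₃
  have h5 := card_union_add_card_inter U₁ U₂
  have h6 := card_union_add_card_inter (U₁ ∪ U₂) U₃
  have h7 : 1 ≤ (U₁ ∩ U₂).card := card_pos.2 ⟨b, mem_inter.2 ⟨hb₁, hb₂⟩⟩
  -- The overlaps cost at least 1 + 2 vertices, worth 12 = 3 · 6 - 6, exactly what tightness of the
  -- triple union needs.
  have h8 : 2 ≤ ((U₁ ∪ U₂) ∩ U₃).card := by
    rw [← card_pair hac]
    apply card_le_card
    intro x
    simp only [mem_insert, mem_singleton]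
    rintro (rfl | rfl) <;> simp [*]
  omega

/-- Two of three neighbours of `v` can be joined by a new edge once `v` is removed. -/
lemma PinnedSparse.exists_free_pair (hH : PinnedSparse H X) (hv : v ∉ X)
    (hab : a ≠ b) (hac : a ≠ c) (hbc : b ≠ c) (ha : H.Adj v a) (hb : H.Adj v b)
    (hc : H.Adj v c) :
    ∃ a b c, a ≠ b ∧ c ≠ a ∧ c ≠ b ∧ H.Adj v a ∧ H.Adj v b ∧ H.Adj v c ∧
      ∀ U : Finset V, v ∉ U → a ∈ U → b ∈ U → pinnedWeight H X U + 8 ≤ 4 * U.card := by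
  -- All weights are even, so a set without room for a further edge is tight.
  have key : ∀ {U : Finset V} {a b : V}, a ∈ U → b ∈ U → a ≠ b →
      ¬ pinnedWeight H X U + 8 ≤ 4 * U.card → 4 * U.card ≤ pinnedWeight H X U + 6 := by
    intro U a b ha hb hab h
    obtain ⟨k, hk⟩ := even_adjPairs H U
    unfold pinnedWeight at *
    omega
  by_contra! hcon
  obtain ⟨U₁, h1, h2, h3, h4⟩ := hcon a b c hab hac.symm hbc.symm ha hb hc
  obtain ⟨U₂, i1, i2, i3, i4⟩ := hcon b c a hbc hab hac hb hc ha
  obtain ⟨U₃, j1, j2, j3, j4⟩ := hcon a c b hac hab.symm hbc ha hc hb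
  exact hH.exists_not_tight_pair hv hab hac hbc ha hb hc h1 i1 j1 h2 h3 i2 i3 j2 j3
    (key h2 h3 hab (by omega)) (key i2 i3 hbc (by omega)) (key j2 j3 hac (by omega))

lemma adjPairs_sup_edge (hab : a ≠ b) (h : ¬ H.Adj a b) (U : Finset V) :
    adjPairs (H ⊔ SimpleGraph.edge a b) U = adjPairs H U + if a ∈ U ∧ b ∈ U then 2 else 0 := by
  unfold adjPairs
  split_ifs with hU
  · have h2 : ({(a, b), (b, a)} : Finset (V × V)).card = 2 := card_pair (by simp [hab])
    rw [← h2, ← card_union_of_disjoint]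
    · congr 1
      ext ⟨x, y⟩
      simp only [SimpleGraph.interedges, Rel.mem_interedges_iff, mem_union, mem_insert,
        mem_singleton, Prod.mk.injEq, SimpleGraph.sup_adj, SimpleGraph.edge_adj]
      constructor
      · tauto
      · rintro (⟨h1, h2, h3⟩ | ⟨rfl, rfl⟩ | ⟨rfl, rfl⟩)
        · exact ⟨h1, h2, Or.inl h3⟩
        · exact ⟨hU.1, hU.2, Or.inr ⟨by simp, hab⟩⟩
        · exact ⟨hU.2, hU.1, Or.inr ⟨by simp, hab.symm⟩⟩
    · rw [disjoint_right]
      rintro ⟨x, y⟩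
      simp only [mem_insert, mem_singleton, Prod.mk.injEq, SimpleGraph.interedges,
        Rel.mem_interedges_iff]
      rintro (⟨rfl, rfl⟩ | ⟨rfl, rfl⟩) ⟨-, -, h3⟩
      · exact h h3
      · exact h h3.symm
  · congr 1
    ext ⟨x, y⟩
    simp only [SimpleGraph.interedges, Rel.mem_interedges_iff, SimpleGraph.sup_adj,
      SimpleGraph.edge_adj]
    constructor
    · rintro ⟨h1, h2, h3 | ⟨⟨rfl, rfl⟩ | ⟨rfl, rfl⟩, -⟩⟩
      · exact ⟨h1, h2, h3⟩
      · exact absurd ⟨h1, h2⟩ hU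
      · exact absurd ⟨h2, h1⟩ hU
    · tauto

lemma PinnedSparse.add_edge_isolateVertex (hH : PinnedSparse H X) (hv : v ∉ X) (hab : a ≠ b)
    (hnab : ¬ H.Adj a b) (hav : a ≠ v) (hbv : b ≠ v)
    (hU : ∀ U : Finset V, v ∉ U → a ∈ U → b ∈ U → pinnedWeight H X U + 8 ≤ 4 * U.card) :
    PinnedSparse (isolateVertex H v ⊔ SimpleGraph.edge a b) X := by
  have key : ∀ U : Finset V, v ∉ U → 2 ≤ U.card →
      pinnedWeight (isolateVertex H v ⊔ SimpleGraph.edge a b) X U + 6 ≤ 4 * U.card := by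
    intro U hvU hcard
    have h1 := hU U hvU
    have h2 := hH U hcard
    unfold pinnedWeight at *
    rw [adjPairs_sup_edge hab (fun h => hnab (isolateVertex_le H v h)),
      adjPairs_isolateVertex hvU]
    split_ifs with h
    · have := h1 h.1 h.2
      omega
    · omega
  intro U hcard
  by_cases hvU : v ∈ U
  · have hd : degreeIn (isolateVertex H v ⊔ SimpleGraph.edge a b) v (U.erase v) = 0 := by
      refine degreeIn_eq_zero fun x _ => ?_
      simp only [SimpleGraph.sup_adj, isolateVertex_adj, SimpleGraph.edge_adj]
      rintro (h | ⟨⟨h, -⟩ | ⟨h, -⟩, -⟩)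
      · exact h.2.1 rfl
      · exact hav h.symm
      · exact hbv h.symm
    have h1 := adjPairs_insert (H := isolateVertex H v ⊔ SimpleGraph.edge a b)
      (notMem_erase v U)
    have h2 := card_erase_add_one hvU
    have h3 : U ∩ X = U.erase v ∩ X := by
      rw [← insert_erase hvU, insert_inter_of_notMem hv, erase_insert (notMem_erase v U)]
    rw [insert_erase hvU, hd] at h1
    -- Sparsity says nothing about a single vertex; its weight is zero, as the pin term is
    -- truncated.
    rcases Nat.lt_or_ge (U.erase v).card 2 with h | h
    · have h4 : adjPairs (isolateVertex H v ⊔ SimpleGraph.edge a b) (U.erase v) = 0 :=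
        adjPairs_eq_zero (by omega)
      have h5 : (U.erase v ∩ X).card ≤ (U.erase v).card := card_le_card inter_subset_left
      unfold pinnedWeight
      rw [h3]
      omega
    · have := key _ (notMem_erase v U) h
      unfold pinnedWeight at *
      rw [h3]
      omega
  · exact key U hvU hcard

/-- If all free vertices had degree at least 4, their degrees would exhaust the sum of all degrees.
No edge would then meet X, and `S \ X` would induce more edges than sparsity allows. -/
lemma PinnedSparse.exists_degree_le_three (hH : PinnedSparse H X) (hXS : X ⊆ S) (hne : S ≠ X)
    (hS : adjPairs H S = 4 * (S \ X).card) : ∃ v ∈ S \ X, degreeIn H v S ≤ 3 := by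
  by_contra! hcon
  have hT : 0 < (S \ X).card := card_pos.2 (by
    rw [sdiff_nonempty]
    exact fun h => hne (h.antisymm hXS))
  have h1 : ∑ v ∈ S \ X, 4 ≤ ∑ v ∈ S \ X, degreeIn H v S := sum_le_sum fun v hv => hcon v hv
  have hsplit : ∀ x, degreeIn H x S = degreeIn H x (S \ X) + degreeIn H x X := fun x => by
    rw [← degreeIn_union sdiff_disjoint, sdiff_union_of_subset hXS]
  have h2 : ∑ v ∈ S \ X, degreeIn H v S =
      adjPairs H (S \ X) + ∑ v ∈ S \ X, degreeIn H v X := by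
    rw [sum_congr rfl fun x _ => hsplit x, sum_add_distrib, ← adjPairs_eq_sum]
  have h3 : adjPairs H S = ∑ v ∈ S \ X, degreeIn H v S + ∑ v ∈ X, degreeIn H v S := by
    rw [adjPairs_eq_sum, sum_sdiff hXS]
  have h4 : ∑ v ∈ X, degreeIn H v (S \ X) ≤ ∑ v ∈ X, degreeIn H v S :=
    sum_le_sum fun x _ => by rw [hsplit]; omega
  rw [sum_degreeIn_comm] at h4
  have h5 : adjPairs H (S \ X) < 4 * (S \ X).card := by
    rcases Nat.lt_or_ge (S \ X).card 2 with h | h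
    · rw [adjPairs_eq_zero (by omega)]; omega
    · have := hH _ h
      unfold pinnedWeight at this
      omega
  rw [sum_const, smul_eq_mul] at h1
  omega

/-- With at most one pin, sparsity of S allows at most 4|S| - 6 adjacent pairs, fewer than the
required 4|S ∖ X|. -/
lemma PinnedSparse.two_le_card_pins (hH : PinnedSparse H X) (hXS : X ⊆ S) (hne : S ≠ X)
    (hS : adjPairs H S = 4 * (S \ X).card) : 2 ≤ X.card := by
  have h1 := card_sdiff_add_card_eq_card hXS
  have hT : 0 < (S \ X).card := card_pos.2 (by
    rw [sdiff_nonempty]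
    exact fun h => hne (h.antisymm hXS))
  rcases Nat.lt_or_ge S.card 2 with h | h
  · rw [adjPairs_eq_zero (by omega)] at hS
    omega
  · have := hH _ h
    unfold pinnedWeight at this
    rw [inter_eq_right.2 hXS] at this
    omega

/-- A tight pinned graph with a free vertex arises from a smaller one by attaching a vertex `v` to
two vertices, or by replacing an edge `ab` by a vertex `v` joined to `a`, `b` and a third vertex. -/
theorem PinnedSparse.exists_reduction (hH : PinnedSparse H X) (hXS : X ⊆ S) (hne : S ≠ X)
    (hHS : ∀ x y, H.Adj x y → x ∈ S) (hS : adjPairs H S = 4 * (S \ X).card) :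
    ∃ v ∈ S \ X, ∃ a ∈ S.erase v, ∃ b ∈ S.erase v, a ≠ b ∧ H.Adj v a ∧ H.Adj v b ∧
      ∃ H' : SimpleGraph V, PinnedSparse H' X ∧ (∀ x y, H'.Adj x y → x ∈ S.erase v) ∧
        adjPairs H' (S.erase v) = 4 * (S.erase v \ X).card ∧
        (H' ≤ H ∨ ∃ c ∈ S.erase v, c ≠ a ∧ c ≠ b ∧ H.Adj v c ∧ ¬ (a ∈ X ∧ b ∈ X ∧ c ∈ X) ∧
          isolateVertex H v ⊔ SimpleGraph.edge a b = H') := by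
  obtain ⟨v, hvT, hdeg⟩ := hH.exists_degree_le_three hXS hne hS
  have hX2 := hH.two_le_card_pins hXS hne hS
  obtain ⟨hvS, hvX⟩ := mem_sdiff.1 hvT
  have hXe : X ⊆ S.erase v := fun x hx => mem_erase.2 ⟨fun h => hvX (h ▸ hx), hXS hx⟩
  have hNe : degreeIn H v (S.erase v) = degreeIn H v S := by
    rw [← degreeIn_insert_self, insert_erase hvS]
  have hins := adjPairs_insert (H := H) (notMem_erase v S)
  rw [insert_erase hvS, hNe] at hins
  have hc1 := card_erase_add_one hvS
  have hc2 := card_sdiff_add_card_eq_card hXS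
  have hc3 := card_sdiff_add_card_eq_card hXe
  have hsp := hH (S.erase v) (hX2.trans (card_le_card hXe))
  unfold pinnedWeight at hsp
  rw [inter_eq_right.2 hXe] at hsp
  have hmem : ∀ {x}, H.Adj v x → x ∈ S.erase v := fun h =>
    mem_erase.2 ⟨h.ne', hHS _ _ h.symm⟩
  -- Sparsity of `S.erase v`, which contains all pins, bounds what remains after deleting `v`, so
  -- the degree is at least 2.
  rcases (show degreeIn H v S = 2 ∨ degreeIn H v S = 3 by omega) with h | h
  · obtain ⟨a, b, hab, hN⟩ := card_eq_two.1 h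
    have ha : H.Adj v a := (mem_filter.1 (hN ▸ mem_insert_self a {b} : a ∈ _)).2
    have hb : H.Adj v b :=
      (mem_filter.1 (hN ▸ mem_insert_of_mem (mem_singleton_self b) : b ∈ _)).2
    refine ⟨v, hvT, a, hmem ha, b, hmem hb, hab, ha, hb, isolateVertex H v,
      hH.mono (isolateVertex_le H v), fun x y hxy => mem_erase.2 ⟨hxy.2.1, hHS _ _ hxy.1⟩, ?_,
      Or.inl (isolateVertex_le H v)⟩
    rw [adjPairs_isolateVertex (notMem_erase v S)]
    omega
  · obtain ⟨a, b, c, hab, hac, hbc, hN⟩ := card_eq_three.1 h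
    have ha : H.Adj v a := (mem_filter.1 ((Finset.ext_iff.1 hN a).2 (by simp))).2
    have hb : H.Adj v b := (mem_filter.1 ((Finset.ext_iff.1 hN b).2 (by simp))).2
    have hc : H.Adj v c := (mem_filter.1 ((Finset.ext_iff.1 hN c).2 (by simp))).2
    obtain ⟨a, b, c, hab, hca, hcb, ha, hb, hc, hU⟩ :=
      hH.exists_free_pair hvX hab hac hbc ha hb hc
    -- Adjacent a and b would form a tight set.
    have hnab : ¬ H.Adj a b := by
      intro h
      have h1 := hU {a, b} (by simp [ha.ne, hb.ne]) (by simp) (by simp)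
      have h2 : adjPairs H {a, b} = 2 := by
        rw [adjPairs_insert (by simpa using hab), adjPairs_eq_zero (by simp)]
        simp [degreeIn, filter_singleton, h]
      unfold pinnedWeight at h1
      rw [card_pair hab] at h1
      omega
    refine ⟨v, hvT, a, hmem ha, b, hmem hb, hab, ha, hb, _,
      hH.add_edge_isolateVertex hvX hab hnab ha.ne' hb.ne' hU, ?_, ?_,
      Or.inr ⟨c, hmem hc, hca, hcb, hc, ?_, rfl⟩⟩
    · intro x y
      simp only [SimpleGraph.sup_adj, SimpleGraph.edge_adj]
      rintro (hxy | ⟨⟨rfl, -⟩ | ⟨rfl, -⟩, -⟩)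
      · exact mem_erase.2 ⟨hxy.2.1, hHS _ _ hxy.1⟩
      · exact hmem ha
      · exact hmem hb
    · rw [adjPairs_sup_edge hab (fun h => hnab (isolateVertex_le H v h)),
        adjPairs_isolateVertex (notMem_erase v S),
        if_pos ⟨hmem ha, hmem hb⟩]
      omega
    -- X is tight by its pin term alone, so it cannot contain three neighbours of `v`.
    · rintro ⟨haX, hbX, hcX⟩
      have := hH.not_tight_of_three hvX hvX hab hca.symm hcb.symm ha hb hc haX hbX hcX
      unfold pinnedWeight at this
      rw [inter_self] at this
      omega

end Sparsity

/-! ### Placing the joints by induction. -/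

section GenericPosition

open scoped Classical

variable {V : Type*} {H : SimpleGraph V} {X S : Finset V} {q : V → Fin 3 → ℝ} {v : V}

/-- The joints in `S` are distinct points, and collinear triples occur among the pins `X` only. -/
structure InGeneralPosition (q : V → Fin 3 → ℝ) (X S : Finset V) : Prop where
  ne_zero : ∀ a ∈ S, q a ≠ 0
  cross_ne_zero : ∀ a ∈ S, ∀ b ∈ S, a ≠ b → q a ⨯₃ q b ≠ 0
  triple_ne_zero : ∀ a ∈ S, ∀ b ∈ S, ∀ c ∈ S, a ≠ b → b ≠ c → c ≠ a →
    ¬ (a ∈ X ∧ b ∈ X ∧ c ∈ X) → q a ⬝ᵥ (q b ⨯₃ q c) ≠ 0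

lemma InGeneralPosition.congr {q' : V → Fin 3 → ℝ} (h : InGeneralPosition q X S)
    (hq : ∀ a ∈ S, q a = q' a) : InGeneralPosition q' X S := by
  constructor
  · intro a ha
    rw [← hq a ha]
    exact h.ne_zero a ha
  · intro a ha b hb hab
    rw [← hq a ha, ← hq b hb]
    exact h.cross_ne_zero a ha b hb hab
  · intro a ha b hb c hc
    rw [← hq a ha, ← hq b hb, ← hq c hc]
    exact h.triple_ne_zero a ha b hb c hc

variable [DecidableEq V]

/-- Avoiding all lines through two old joints also avoids the joints themselves, since each lies on
such a line once there are two. -/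
lemma InGeneralPosition.insert (h : InGeneralPosition q X S) (hv : v ∉ S) (hcard : 2 ≤ S.card)
    (hvq : ∀ e ∈ S.offDiag, q v ⬝ᵥ (q e.1 ⨯₃ q e.2) ≠ 0) :
    InGeneralPosition q X (insert v S) := by
  have hvq' : ∀ b ∈ S, ∀ c ∈ S, b ≠ c → q v ⬝ᵥ (q b ⨯₃ q c) ≠ 0 := fun b hb c hc hbc =>
    hvq (b, c) (Finset.mem_offDiag.2 ⟨hb, hc, hbc⟩)
  have hcross : ∀ b ∈ S, q v ⨯₃ q b ≠ 0 := by
    intro b hb h0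
    obtain ⟨c, hc, hcb⟩ := Finset.exists_mem_ne hcard b
    exact hvq' b hb c hc hcb.symm (dotProduct_cross_eq_zero_left h0 (q c))
  constructor
  · intro a ha
    rcases Finset.mem_insert.1 ha with rfl | ha
    · intro h0
      obtain ⟨b, hb⟩ := Finset.card_pos.1 (show 0 < S.card by omega)
      apply hcross b hb
      rw [h0, map_zero, LinearMap.zero_apply]
    · exact h.ne_zero a ha
  · intro a ha b hb hab
    rcases Finset.mem_insert.1 ha with rfl | ha <;> rcases Finset.mem_insert.1 hb with rfl | hb
    · exact absurd rfl hab
    · exact hcross b hb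
    · rw [← cross_anticomm]
      exact neg_ne_zero.2 (hcross a (Finset.mem_of_mem_insert_of_ne ha hab))
    · exact h.cross_ne_zero a ha b hb hab
  · intro a ha b hb c hc hab hbc hca hX
    rcases Finset.mem_insert.1 ha with rfl | ha
    · exact hvq' b (Finset.mem_of_mem_insert_of_ne hb hab.symm) c
        (Finset.mem_of_mem_insert_of_ne hc hca) hbc
    rcases Finset.mem_insert.1 hb with rfl | hb
    · rw [triple_product_permutation]
      exact hvq' c (Finset.mem_of_mem_insert_of_ne hc hbc.symm) a
        (Finset.mem_of_mem_insert_of_ne ha hab) hca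
    rcases Finset.mem_insert.1 hc with rfl | hc
    · rw [triple_product_permutation, triple_product_permutation]
      exact hvq' a (Finset.mem_of_mem_insert_of_ne ha hca.symm) b
        (Finset.mem_of_mem_insert_of_ne hb hbc) hab
    · exact h.triple_ne_zero a ha b hb c hc hab hbc hca hX

/-- A tight pinned graph is infinitesimally rigid at some joint configuration that extends a given
configuration of the pins. -/
theorem PinnedSparse.exists_jointsFixed [Finite V] {q₀ : V → Fin 3 → ℝ}
    (hne : ∀ x ∈ X, q₀ x ≠ 0) (hcross : ∀ x ∈ X, ∀ y ∈ X, x ≠ y → q₀ x ⨯₃ q₀ y ≠ 0)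
    (hH : PinnedSparse H X) (hXS : X ⊆ S) (hHS : ∀ x y, H.Adj x y → x ∈ S)
    (hS : adjPairs H S = 4 * (S \ X).card) :
    ∃ q : V → Fin 3 → ℝ, (∀ x ∈ X, q x = q₀ x) ∧ InGeneralPosition q X S ∧
      JointsFixed H X S q := by
  induction hn : (S \ X).card generalizing S H with
  | zero =>
    have hSX : S = X := by
      rw [Finset.card_eq_zero, Finset.sdiff_eq_empty_iff_subset] at hn
      exact hn.antisymm hXS
    subst hSX
    exact ⟨q₀, fun _ _ => rfl, ⟨hne, hcross, fun a ha b hb c hc _ _ _ h => absurd ⟨ha, hb, hc⟩ h⟩,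
      fun m _ h => h⟩
  | succ n ih =>
    have hSX : S ≠ X := by
      rintro rfl
      simp at hn
    have hX2 := hH.two_le_card_pins hXS hSX hS
    obtain ⟨v, hvT, a, ha, b, hb, hab, hva, hvb, H', hH', hH'S, hS', hcase⟩ :=
      hH.exists_reduction hXS hSX hHS hS
    obtain ⟨hvS, hvX⟩ := Finset.mem_sdiff.1 hvT
    have hXe : X ⊆ S.erase v := fun x hx => Finset.mem_erase.2 ⟨fun h => hvX (h ▸ hx), hXS hx⟩
    have hcard : (S.erase v \ X).card = n := by
      have h1 := Finset.card_erase_add_one hvS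
      have h2 := Finset.card_sdiff_add_card_eq_card hXS
      have h3 := Finset.card_sdiff_add_card_eq_card hXe
      omega
    obtain ⟨q, hqX, hgen, hfix⟩ := ih hH' hXe hH'S hS' hcard
    have hvS' := Finset.notMem_erase v S
    have hupd : ∀ y, ∀ x ∈ S.erase v, q x = Function.update q v y x := fun y x hx =>
      (Function.update_of_ne (Finset.ne_of_mem_erase hx) _ _).symm
    have hfix' : ∀ y, JointsFixed H' X (S.erase v : Finset V) (Function.update q v y) := fun y =>
      hfix.congr (fun x z h => Finset.mem_coe.2 (hH'S x z h)) (Finset.coe_subset.2 hXe)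
        fun x hx => hupd y x (Finset.mem_coe.1 hx)
    have hSins : (S : Set V) = insert v ((S.erase v : Finset V) : Set V) := by
      rw [← Finset.coe_insert, Finset.insert_erase hvS]
    -- It is enough to have rigidity near one position of `v`, away from the lines through two old
    -- joints: an open set contains a point off these finitely many lines.
    suffices hO : ∃ y₀ : Fin 3 → ℝ, ∃ O ∈ nhds y₀, ∀ y ∈ O,
        (∀ e ∈ (S.erase v).offDiag, y ⬝ᵥ (q e.1 ⨯₃ q e.2) ≠ 0) →
        JointsFixed H X S (Function.update q v y) by
      obtain ⟨y₀, O, hO, hrigid⟩ := hO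
      obtain ⟨y, hyO, hy⟩ := exists_mem_nhds_forall_dotProduct_ne_zero (S.erase v).offDiag
        (fun e => q e.1 ⨯₃ q e.2)
        (fun e he => by
          obtain ⟨h1, h2, h3⟩ := Finset.mem_offDiag.1 he
          exact hgen.cross_ne_zero _ h1 _ h2 h3) hO
      refine ⟨Function.update q v y, fun x hx => ?_, ?_, hrigid y hyO hy⟩
      · rw [← hupd y x (hXe hx), hqX x hx]
      · rw [← Finset.insert_erase hvS]
        refine (hgen.congr (hupd y)).insert hvS' (hX2.trans (Finset.card_le_card hXe)) ?_
        intro e he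
        obtain ⟨h1, h2, h3⟩ := Finset.mem_offDiag.1 he
        rw [Function.update_self, ← hupd y _ h1, ← hupd y _ h2]
        exact hy e he
    rcases hcase with hle | ⟨c, hc, hca, hcb, hvc, hcX, rfl⟩
    -- Every position off the lines works, so the base point 0 is arbitrary.
    · refine ⟨0, Set.univ, Filter.univ_mem, fun y _ hy => ?_⟩
      rw [hSins]
      refine (hfix' y).insert_of_two_bars hle (Finset.mem_coe.2 ha) (Finset.mem_coe.2 hb) hva hvb ?_
      rw [Function.update_self, ← hupd y a ha, ← hupd y b hb]
      exact hy (a, b) (Finset.mem_offDiag.2 ⟨ha, hb, hab⟩)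
    · have hcab := hgen.cross_ne_zero a ha b hb hab
      -- The special position of `v`, on the line of the replaced edge; it violates general position
      -- and is perturbed afterwards.
      have hrigid : JointsFixed H X S (Function.update q v (q a + q b)) := by
        rw [hSins]
        refine (hfix' _).insert_of_subdivide ?_ (Finset.mem_coe.2 ha) (Finset.mem_coe.2 hc)
          hva hvb hvc ?_ ?_
        · intro x y h
          rw [SimpleGraph.sup_adj, SimpleGraph.edge_adj] at h
          exact h.imp (fun h => h.1) fun h => h.1
        · rw [← hupd _ a ha, ← hupd _ b hb, ← hupd _ c hc]
          exact hgen.triple_ne_zero a ha b hb c hc hab hcb.symm hca hcX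
        · rw [← hupd _ a ha, ← hupd _ b hb, Function.update_self]
      have hev := hrigid.eventually (fun x y h => Finset.mem_coe.2 (hHS x y h)) (by
        intro x hx
        by_cases hxv : x = v
        · subst hxv
          rw [Function.update_self]
          intro h0
          apply hcab
          rw [eq_neg_of_add_eq_zero_right h0, map_neg, cross_self, neg_zero]
        · rw [Function.update_of_ne hxv]
          exact hgen.ne_zero x (Finset.mem_erase.2 ⟨hxv, Finset.mem_coe.1 hx⟩))
      have hcont : Continuous fun y : Fin 3 → ℝ => Function.update q v y :=
        continuous_const.update v continuous_id
      exact ⟨q a + q b, _, hcont.continuousAt.eventually hev, fun y hy _ => hy⟩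

end GenericPosition

/-! ### Dimension counts for the rigidity map. -/

section BarMap

open scoped Classical

variable {V ι κ : Type*} {r : V → Fin 3 → ℝ} {s t : ι → V} {B : Set V}

/-- Extension of an assignment of infinitesimal motions by zero. -/
noncomputable def extendByRest (B : Set V) : (B → Fin 3 → ℝ) →ₗ[ℝ] (V → Fin 3 → ℝ) :=
  LinearMap.pi fun v => if h : v ∈ B then LinearMap.proj ⟨v, h⟩ else 0

lemma extendByRest_of_mem (m : B → Fin 3 → ℝ) {v : V} (h : v ∈ B) :
    extendByRest B m v = m ⟨v, h⟩ := by
  simp [extendByRest, h]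

lemma extendByRest_of_notMem (m : B → Fin 3 → ℝ) {v : V} (h : v ∉ B) :
    extendByRest B m v = 0 := by
  simp [extendByRest, h]

/-- The rigidity map of the framework whose bars join `s e` to `t e` and whose free joints are those
in `B`. -/
noncomputable def barMap (r : V → Fin 3 → ℝ) (s t : ι → V) (B : Set V) :
    (B → Fin 3 → ℝ) →ₗ[ℝ] (ι → ℝ) where
  toFun m e := (extendByRest B m (s e) - extendByRest B m (t e)) ⬝ᵥ (r (s e) ⨯₃ r (t e))
  map_add' m n := by
    ext e
    simp only [map_add, Pi.add_apply, sub_dotProduct, add_dotProduct]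
    ring
  map_smul' c m := by
    ext e
    simp only [map_smul, Pi.smul_apply, sub_dotProduct, smul_dotProduct, smul_eq_mul,
      RingHom.id_apply]
    ring

lemma barMap_apply (m : B → Fin 3 → ℝ) (e : ι) : barMap r s t B m e =
    (extendByRest B m (s e) - extendByRest B m (t e)) ⬝ᵥ (r (s e) ⨯₃ r (t e)) := rfl

lemma finrank_motions [Finite B] : Module.finrank ℝ (B → Fin 3 → ℝ) = 3 * Nat.card B := by
  have := Fintype.ofFinite B
  rw [Module.finrank_pi_fintype]
  simp [mul_comm]

/-- If all motions are danglings, then there are at least two bars for each free joint. -/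
lemma two_mul_card_le_of_ker_barMap [Finite B] [Finite ι]
    (h : ∀ m, barMap r s t B m = 0 → ∀ v : B, ∃ c : ℝ, m v = c • r v) :
    2 * Nat.card B ≤ Nat.card ι := by
  have := Fintype.ofFinite B
  have := Fintype.ofFinite ι
  -- The image of `D` consists of the danglings, so the kernel has dimension at most |B| and the
  -- rank is at least 3|B| - |B|.
  let D : (B → ℝ) →ₗ[ℝ] (B → Fin 3 → ℝ) :=
    LinearMap.pi fun v => (LinearMap.toSpanSingleton ℝ _ (r v)) ∘ₗ LinearMap.proj v
  have hle : LinearMap.ker (barMap r s t B) ≤ LinearMap.range D := by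
    intro m hm
    choose c hc using h m hm
    exact ⟨c, funext fun v => (hc v).symm⟩
  have h1 := Submodule.finrank_mono hle
  have h2 := LinearMap.finrank_range_le D
  have h3 := (barMap r s t B).finrank_range_add_finrank_ker
  have h4 := Submodule.finrank_le (LinearMap.range (barMap r s t B))
  rw [finrank_motions] at h3
  rw [Module.finrank_fintype_fun_eq_card] at h2 h4
  rw [Nat.card_eq_fintype_card] at *
  rw [Nat.card_eq_fintype_card]
  omega

/-- A nonzero infinitesimal rigid motion `k` keeps only the point [k], so it cannot keep two
distinct points. -/
lemma eq_zero_of_cross_of_cross {k a b : Fin 3 → ℝ} (hab : a ⨯₃ b ≠ 0) (ha : k ⨯₃ a = 0)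
    (hb : k ⨯₃ b = 0) : k = 0 := by
  by_contra hk
  have hk' : ∀ {x : Fin 3 → ℝ}, k ⨯₃ x = 0 → ∃ c : ℝ, x = c • k := fun {x} h =>
    exists_smul_of_cross_eq_zero hk (by rw [← cross_anticomm, h, neg_zero])
  obtain ⟨c, rfl⟩ := hk' ha
  obtain ⟨d, rfl⟩ := hk' hb
  apply hab
  simp [cross_self]

/-- Bars with independent constraints are bounded by the degrees of freedom of the free joints that
are not rigid motions in `K` compatible with the other joints. -/
lemma card_add_finrank_le_of_surjective_barMap [Finite B] [Finite ι] [Nonempty ι]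
    (hr : ∀ v, r v ≠ 0) (hsurj : Function.Surjective (barMap r s t B))
    (K : Submodule ℝ (Fin 3 → ℝ)) (hs : ∀ e, s e ∉ B → ∀ k ∈ K, k ⨯₃ r (s e) = 0)
    (ht : ∀ e, t e ∉ B → ∀ k ∈ K, k ⨯₃ r (t e) = 0) :
    Nat.card ι + Module.finrank ℝ K ≤ 2 * Nat.card B := by
  have := Fintype.ofFinite B
  have := Fintype.ofFinite ι
  -- A dangling at each free joint plus a common rigid motion from `K`. This map is injective with
  -- image in the kernel of `barMap`, which has dimension 3|B| - |ι| by surjectivity.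
  let φ : (B → ℝ) × K →ₗ[ℝ] (B → Fin 3 → ℝ) :=
    LinearMap.pi fun v => LinearMap.coprod
      ((LinearMap.toSpanSingleton ℝ _ (r v)) ∘ₗ LinearMap.proj v) K.subtype
  have hφ : ∀ x v, φ x v = x.1 v • r v + x.2 := fun x v => rfl
  have hinj : Function.Injective φ := by
    rw [← LinearMap.ker_eq_bot, LinearMap.ker_eq_bot']
    rintro ⟨c, k⟩ h0
    have h1 : ∀ v : B, c v • r v + (k : Fin 3 → ℝ) = 0 := fun v => congrFun h0 v
    have h2 : ∀ v ∈ B, (k : Fin 3 → ℝ) ⨯₃ r v = 0 := by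
      intro v hv
      rw [eq_neg_of_add_eq_zero_right (h1 ⟨v, hv⟩)]
      simp [cross_self]
    obtain ⟨e⟩ := ‹Nonempty ι›
    -- Surjectivity forces the ends of a bar to be distinct points. A rigid motion cancelled by
    -- danglings keeps both ends, hence is zero.
    have hcross : r (s e) ⨯₃ r (t e) ≠ 0 := by
      intro h
      obtain ⟨m, hm⟩ := hsurj (fun _ => 1)
      have := congrFun hm e
      rw [barMap_apply, h, dotProduct_zero] at this
      exact zero_ne_one this
    have hk : (k : Fin 3 → ℝ) = 0 := by
      refine eq_zero_of_cross_of_cross hcross ?_ ?_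
      · by_cases h : s e ∈ B
        · exact h2 _ h
        · exact hs e h k k.2
      · by_cases h : t e ∈ B
        · exact h2 _ h
        · exact ht e h k k.2
    refine Prod.ext (funext fun v => ?_) (Subtype.ext hk)
    have := h1 v
    rw [hk, add_zero, smul_eq_zero] at this
    exact this.resolve_right (hr v)
  have hle : LinearMap.range φ ≤ LinearMap.ker (barMap r s t B) := by
    rintro _ ⟨x, rfl⟩
    rw [LinearMap.mem_ker]
    ext e
    -- At each end of a bar the motion differs from the rigid motion `x.2` by a dangling: by
    -- construction at free joints, and because `K` keeps the others. A common motion of all bodies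
    -- satisfies every bar.
    have key : ∀ v, (v ∉ B → ∀ k ∈ K, k ⨯₃ r v = 0) →
        (extendByRest B (φ x) v - (x.2 : Fin 3 → ℝ)) ⨯₃ r v = 0 := by
      intro v hv
      by_cases h : v ∈ B
      · rw [extendByRest_of_mem _ h, hφ]
        simp [cross_self]
      · rw [extendByRest_of_notMem _ h, zero_sub]
        simp [hv h _ x.2.2]
    have := bar_eq_of_cross_eq_zero (key _ (hs e)) (key _ (ht e)) (x.2 : Fin 3 → ℝ) x.2
    rw [add_sub_cancel, add_sub_cancel, sub_self, zero_dotProduct] at this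
    rw [barMap_apply, this, Pi.zero_apply]
  have h1 := Submodule.finrank_mono hle
  have h2 := LinearMap.finrank_range_of_inj hinj
  have h3 := (barMap r s t B).finrank_range_add_finrank_ker
  rw [LinearMap.range_eq_top.2 hsurj, finrank_top, finrank_motions,
    Module.finrank_fintype_fun_eq_card] at h3
  rw [Module.finrank_prod, Module.finrank_fintype_fun_eq_card] at h2
  rw [Nat.card_eq_fintype_card] at *
  rw [Nat.card_eq_fintype_card]
  omega

/-- Independence passes to a subset of the bars, and free joints that these bars do not touch can be
dropped: extend the target by zero and restrict a preimage. -/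
lemma surjective_barMap_comp {B' : Set V} {j : κ → ι} (hj : Function.Injective j) (hB : B' ⊆ B)
    (hs : ∀ e, s (j e) ∈ B → s (j e) ∈ B') (ht : ∀ e, t (j e) ∈ B → t (j e) ∈ B')
    (h : Function.Surjective (barMap r s t B)) :
    Function.Surjective (barMap r (s ∘ j) (t ∘ j) B') := by
  intro g
  obtain ⟨m, hm⟩ := h (Function.extend j g 0)
  refine ⟨fun v => m ⟨v, hB v.2⟩, funext fun e => ?_⟩
  have key : ∀ v, (v ∈ B → v ∈ B') →
      extendByRest B' (fun v => m ⟨v, hB v.2⟩) v = extendByRest B m v := by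
    intro v hv
    by_cases hv' : v ∈ B
    · rw [extendByRest_of_mem _ (hv hv'), extendByRest_of_mem _ hv']
    · rw [extendByRest_of_notMem _ (fun h => hv' (hB h)), extendByRest_of_notMem _ hv']
  have := congrFun hm (j e)
  rw [barMap_apply, hj.extend_apply] at this
  rw [barMap_apply, ← this, Function.comp_apply, Function.comp_apply, key _ (hs e), key _ (ht e)]

lemma surjective_barMap_of_forall [Finite ι]
    (h : ∀ e, ∃ m, barMap r s t B m e ≠ 0 ∧ ∀ f ≠ e, barMap r s t B m f = 0) :
    Function.Surjective (barMap r s t B) := by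
  have := Fintype.ofFinite ι
  rw [← LinearMap.range_eq_top, eq_top_iff, ← (Pi.basisFun ℝ ι).span_eq, Submodule.span_le]
  rintro _ ⟨e, rfl⟩
  obtain ⟨m, hm, hm'⟩ := h e
  refine ⟨(barMap r s t B m e)⁻¹ • m, ?_⟩
  ext f
  rw [map_smul, Pi.basisFun_apply, Pi.smul_apply, smul_eq_mul]
  by_cases hf : f = e
  · subst hf
    simp [hm]
  · simp [hm' f hf, hf]

end BarMap

/-! ### Necessity of the counts. -/

section Frameworks

variable {α β : Type*} {G : Graph α β} {X : Set α} {p : V(G) → RealProjectivePlane}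
  {m : V(G) → Fin 3 → ℝ}

lemma mem_span_trivialDangling_iff {V : Type*} [Finite V] {p : V → RealProjectivePlane}
    {m : V → Fin 3 → ℝ} : m ∈ Submodule.span ℝ (Set.range (trivialDangling p)) ↔
      ∀ v, ∃ c : ℝ, m v = c • (p v).rep := by
  classical
  have := Fintype.ofFinite V
  constructor
  · intro h v
    induction h using Submodule.span_induction with
    | mem m hm =>
      obtain ⟨u, rfl⟩ := hm
      by_cases huv : v = u
      · subst huv
        exact ⟨1, by simp [trivialDangling]⟩
      · exact ⟨0, by simp [trivialDangling, huv]⟩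
    | zero => exact ⟨0, by simp⟩
    | add m n _ _ hm hn =>
      obtain ⟨c, hc⟩ := hm
      obtain ⟨d, hd⟩ := hn
      exact ⟨c + d, by rw [Pi.add_apply, hc, hd, add_smul]⟩
    | smul a m _ hm =>
      obtain ⟨c, hc⟩ := hm
      exact ⟨a * c, by rw [Pi.smul_apply, hc, mul_smul]⟩
  · intro h
    choose c hc using h
    have : m = ∑ v, c v • trivialDangling p v := by
      ext1 v
      rw [hc v, Finset.sum_apply, Finset.sum_eq_single v]
      · simp [trivialDangling]
      · intro u _ hu
        simp [trivialDangling, hu.symm]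
      · simp
    rw [this]
    exact Submodule.sum_mem _ fun v _ =>
      Submodule.smul_mem _ _ (Submodule.subset_span ⟨v, rfl⟩)

lemma forall_dotProduct_barCoord_eq_zero_iff {m a : Fin 3 → ℝ} :
    (∀ b, m ⬝ᵥ barCoord a b = 0) ↔ m ⨯₃ a = 0 := by
  constructor
  · intro h
    -- This choice makes the triple product the squared norm of m × a.
    have h1 := h (m ⨯₃ a)
    rw [barCoord, triple_product_permutation, triple_product_permutation] at h1
    exact dotProduct_self_eq_zero.1 h1
  · exact fun h b => dotProduct_cross_eq_zero_left h b

lemma isPinnedMotion_iff {s t : E(G) → V(G)} (hst : ∀ e : E(G), G.IsLink e (s e) (t e)) :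
    IsPinnedMotion G X p m ↔
      (∀ e, (m (s e) - m (t e)) ⬝ᵥ ((p (s e)).rep ⨯₃ (p (t e)).rep) = 0) ∧
        ∀ v : V(G), (v : α) ∈ X → m v ⨯₃ (p v).rep = 0 := by
  constructor
  · exact fun h => ⟨fun e => h.bar e _ _ (hst e),
      fun v hv => forall_dotProduct_barCoord_eq_zero_iff.1 (h.pin v hv)⟩
  · rintro ⟨h1, h2⟩
    refine ⟨fun e u v huv => ?_, fun v hv => forall_dotProduct_barCoord_eq_zero_iff.2 (h2 v hv)⟩
    have h3 := h1 ⟨e, huv.edge_mem⟩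
    obtain ⟨h4, h5⟩ | ⟨h4, h5⟩ := (hst ⟨e, huv.edge_mem⟩).eq_and_eq_or_eq_and_eq huv
    · rwa [Subtype.ext h4, Subtype.ext h5] at h3
    · rw [Subtype.ext h4, Subtype.ext h5, ← cross_anticomm, dotProduct_neg, ← neg_dotProduct,
        neg_sub] at h3
      exact h3

lemma exists_ends (G : Graph α β) :
    ∃ s t : E(G) → V(G), ∀ e : E(G), G.IsLink e (s e) (t e) := by
  have h : ∀ e : E(G), ∃ u v : V(G), G.IsLink e u v := fun e => by
    obtain ⟨x, y, hxy⟩ := Graph.exists_isLink_of_mem_edgeSet e.2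
    exact ⟨⟨x, hxy.left_mem⟩, ⟨y, hxy.right_mem⟩, hxy⟩
  choose s t hst using h
  exact ⟨s, t, hst⟩

/-- The free joints. -/
def freeJoints (G : Graph α β) (X : Set α) : Set V(G) := {v | (v : α) ∉ X}

lemma mem_freeJoints {v : V(G)} : v ∈ freeJoints G X ↔ (v : α) ∉ X := Iff.rfl

lemma card_freeJoints (G : Graph α β) (X : Set α) :
    Nat.card (freeJoints G X) = (V(G) \ X).ncard := by
  rw [Nat.card_coe_set_eq, ← Set.ncard_image_of_injective _ Subtype.val_injective]
  congr 1
  ext v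
  simp [freeJoints, and_comm]

/-- An infinitesimally rigid pinned framework has at least two bars for each free joint. -/
lemma IsPinnedInfRigid.two_mul_ncard_le (h : IsPinnedInfRigid G X p) (hV : V(G).Finite)
    (hE : E(G).Finite) : 2 * (V(G) \ X).ncard ≤ E(G).ncard := by
  have := hV.to_subtype
  have := hE.to_subtype
  obtain ⟨s, t, hst⟩ := exists_ends G
  rw [← card_freeJoints, ← Nat.card_coe_set_eq E(G)]
  refine two_mul_card_le_of_ker_barMap (r := fun v => (p v).rep) (s := s) (t := t) ?_
  intro m hm v
  have h1 : IsPinnedMotion G X p (extendByRest _ m) := by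
    refine (isPinnedMotion_iff hst).2 ⟨fun e => congrFun hm e, fun v hv => ?_⟩
    rw [extendByRest_of_notMem _ (fun h => mem_freeJoints.1 h hv), map_zero, LinearMap.zero_apply]
  obtain ⟨c, hc⟩ := mem_span_trivialDangling_iff.1 (h _ h1) v
  rw [extendByRest_of_mem _ v.2] at hc
  exact ⟨c, hc⟩

/-- In a minimally rigid framework the bar constraints are independent. -/
lemma IsMinPinnedInfRigid.surjective_barMap (h : IsMinPinnedInfRigid G X p)
    (hE : E(G).Finite) {s t : E(G) → V(G)} (hst : ∀ e : E(G), G.IsLink e (s e) (t e)) :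
    Function.Surjective (barMap (fun v => (p v).rep) s t (freeJoints G X)) := by
  have := hE.to_subtype
  refine surjective_barMap_of_forall fun e => ?_
  have h1 := h.2 e e.2
  unfold IsPinnedInfRigid at h1
  push Not at h1
  obtain ⟨(m : V(G) → Fin 3 → ℝ), hm, hspan⟩ := h1
  have hcross : ∀ v : V(G), (v : α) ∈ X → m v ⨯₃ (p v).rep = 0 := fun v hv =>
    forall_dotProduct_barCoord_eq_zero_iff.1 (hm.pin v hv)
  have hrest : ∀ f, barMap (fun v => (p v).rep) s t (freeJoints G X) (fun v => m v) f =
      (m (s f) - m (t f)) ⬝ᵥ ((p (s f)).rep ⨯₃ (p (t f)).rep) := by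
    intro f
    -- Putting the pins to rest changes `m` by danglings only.
    have key : ∀ v, (m v - extendByRest (freeJoints G X) (fun v => m v) v) ⨯₃ (p v).rep = 0 := by
      intro v
      by_cases hv : (v : α) ∈ X
      · rw [extendByRest_of_notMem _ (fun h => mem_freeJoints.1 h hv), sub_zero, hcross v hv]
      · rw [extendByRest_of_mem _ (mem_freeJoints.2 hv), sub_self, map_zero, LinearMap.zero_apply]
    have := bar_eq_of_cross_eq_zero (key (s f)) (key (t f))
      (extendByRest (freeJoints G X) (fun v => m v) (s f))
      (extendByRest (freeJoints G X) (fun v => m v) (t f))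
    rw [add_sub_cancel, add_sub_cancel] at this
    rw [barMap_apply, this]
  have hother : ∀ f ≠ e, barMap (fun v => (p v).rep) s t (freeJoints G X) (fun v => m v) f = 0 := by
    intro f hf
    rw [hrest]
    exact hm.bar f (s f) (t f) ((Graph.deleteEdges_isLink ..).mpr
      ⟨hst f, fun hfe => hf (Subtype.ext hfe)⟩)
  -- If bar `e` were also respected, `m` would be a motion of the whole rigid framework, hence
  -- trivial.
  refine ⟨fun v => m v, fun h0 => hspan (h.1 m ((isPinnedMotion_iff hst).2 ⟨fun f => ?_, hcross⟩)),
    hother⟩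
  rw [← hrest]
  by_cases hf : f = e
  · rw [hf, h0]
  · exact hother f hf

/-- Necessity of the sparsity condition. -/
theorem IsMinPinnedInfRigid.ncard_le (h : IsMinPinnedInfRigid G X p) (hV : V(G).Finite)
    (hE : E(G).Finite) {F : Set β} (hF : F ⊆ E(G)) (hne : F.Nonempty) :
    (F.ncard : ℤ) ≤ 2 * ((G.incidentVertices F \ X).ncard : ℤ) - 3 + pinBonus G X F := by
  have := hV.to_subtype
  have := (hE.subset hF).to_subtype
  have := hne.to_subtype
  obtain ⟨s, t, hst⟩ := exists_ends G
  let B : Set V(G) := {v | (v : α) ∈ G.incidentVertices F \ X}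
  have hVF : G.incidentVertices F ⊆ V(G) := fun v ⟨e, _, hv⟩ => hv.vertex_mem
  have hB : Nat.card B = (G.incidentVertices F \ X).ncard := by
    rw [Nat.card_coe_set_eq, ← Set.ncard_image_of_injective _ Subtype.val_injective]
    congr 1
    ext v
    simp only [B, Set.mem_image, Subtype.exists, exists_and_right, exists_eq_right]
    exact ⟨fun h => h.2, fun h => ⟨hVF h.1, h⟩⟩
  have hsF : ∀ e : F, (s (Set.inclusion hF e) : α) ∈ G.incidentVertices F := fun e =>
    ⟨e, e.2, (hst (Set.inclusion hF e)).inc_left⟩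
  have htF : ∀ e : F, (t (Set.inclusion hF e) : α) ∈ G.incidentVertices F := fun e =>
    ⟨e, e.2, (hst (Set.inclusion hF e)).inc_right⟩
  have hsurj := surjective_barMap_comp (B' := B) (Set.inclusion_injective hF)
    (fun v hv => hv.2) (fun e h => ⟨hsF e, h⟩) (fun e h => ⟨htF e, h⟩)
    (h.surjective_barMap hE hst)
  have hfin : (X ∩ G.incidentVertices F).Finite := hV.subset (Set.inter_subset_right.trans hVF)
  -- Below, `K` consists of the rigid motions keeping the pins of V(F): all of ℝ³, the rotations
  -- about a single pin, or zero.
  have main : ∀ K : Submodule ℝ (Fin 3 → ℝ),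
      (∀ x : V(G), (x : α) ∈ X ∩ G.incidentVertices F → ∀ k ∈ K, k ⨯₃ (p x).rep = 0) →
      F.ncard + Module.finrank ℝ K ≤ 2 * (G.incidentVertices F \ X).ncard := by
    intro K hK
    rw [← hB, ← Nat.card_coe_set_eq F]
    refine card_add_finrank_le_of_surjective_barMap (fun v => (p v).rep_nonzero) hsurj K ?_ ?_
    · exact fun e he => hK _ ⟨by_contra fun hX => he ⟨hsF e, hX⟩, hsF e⟩
    · exact fun e he => hK _ ⟨by_contra fun hX => he ⟨htF e, hX⟩, htF e⟩
  unfold pinBonus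
  split_ifs with h0 h1
  · rw [Set.ncard_eq_zero hfin] at h0
    have := main ⊤ fun x hx => by rw [h0] at hx; exact hx.elim
    simp at this
    omega
  · obtain ⟨x, hx⟩ := Set.ncard_eq_one.1 h1
    have hxF : x ∈ X ∩ G.incidentVertices F := hx ▸ rfl
    have := main (ℝ ∙ (p ⟨x, hVF hxF.2⟩).rep) fun y hy k hk => by
      rw [hx] at hy
      obtain ⟨c, rfl⟩ := Submodule.mem_span_singleton.1 hk
      have : y = ⟨x, hVF hxF.2⟩ := Subtype.ext hy
      rw [this, map_smul, LinearMap.smul_apply, cross_self, smul_zero]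
    rw [finrank_span_singleton (p ⟨x, hVF hxF.2⟩).rep_nonzero] at this
    omega
  · have := main ⊥ fun x _ k hk => by
      rw [(Submodule.mem_bot ℝ).1 hk, map_zero, LinearMap.zero_apply]
    omega

theorem IsMinPinnedInfRigid.ncard_eq (h : IsMinPinnedInfRigid G X p) (hV : V(G).Finite)
    (hE : E(G).Finite) : E(G).ncard = 2 * (V(G) \ X).ncard := by
  refine le_antisymm ?_ (h.1.two_mul_ncard_le hV hE)
  have := hV.to_subtype
  have := hE.to_subtype
  rcases E(G).eq_empty_or_nonempty with h0 | h0
  · simp [h0]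
  have := h0.to_subtype
  obtain ⟨s, t, hst⟩ := exists_ends G
  have := card_add_finrank_le_of_surjective_barMap (fun v => (p v).rep_nonzero)
    (h.surjective_barMap hE hst) ⊥ (by simp) (by simp)
  rw [Nat.card_coe_set_eq, card_freeJoints] at this
  omega

/-- A rigid framework with two bars for each free joint is minimally rigid. -/
lemma IsPinnedInfRigid.isMinPinnedInfRigid (h : IsPinnedInfRigid G X p) (hV : V(G).Finite)
    (hE : E(G).Finite) (hcard : E(G).ncard = 2 * (V(G) \ X).ncard) :
    IsMinPinnedInfRigid G X p := by
  refine ⟨h, fun e he hrigid => ?_⟩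
  have h1 := hrigid.two_mul_ncard_le hV (hE.subset (Graph.deleteEdges_le.edgeSet_mono))
  have h2 : E(G.deleteEdges {e}).ncard = (E(G) \ {e}).ncard := rfl
  have h3 := Set.ncard_sdiff_singleton_lt_of_mem he hE
  have h4 : V(G.deleteEdges {e}) = V(G) := rfl
  rw [h4] at h1
  omega

end Frameworks

/-! ### From the counts of a multigraph to a rigid framework. -/

section Sufficiency

open scoped Classical

variable {α β : Type*} {G : Graph α β} {X : Set α}

/-- The simple graph on the vertices of `G` with the same adjacent pairs of distinct vertices. -/
def Graph.simpleGraph (G : Graph α β) : SimpleGraph V(G) where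
  Adj u v := u ≠ v ∧ G.Adj u v
  symm := ⟨fun _ _ h => ⟨h.1.symm, h.2.symm⟩⟩
  loopless := ⟨fun _ h => h.1 rfl⟩

/-- The edges of `G` with both ends in `U`. -/
def Graph.inducedEdges (G : Graph α β) (U : Set V(G)) : Set β :=
  {e | ∃ u ∈ U, ∃ v ∈ U, G.IsLink e u v}

lemma Graph.inducedEdges_subset (G : Graph α β) (U : Set V(G)) : G.inducedEdges U ⊆ E(G) :=
  fun _ ⟨_, _, _, _, h⟩ => h.edge_mem

/-- Double counting: each adjacent ordered pair is linked by some edge, and an edge links at most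
two ordered pairs. -/
lemma adjPairs_le_two_mul_ncard (hE : E(G).Finite) (U : Finset V(G)) :
    adjPairs G.simpleGraph U ≤ 2 * (G.inducedEdges U).ncard := by
  have hfin := hE.subset (G.inducedEdges_subset U)
  have h := Finset.card_mul_le_card_mul (s := G.simpleGraph.interedges U U) (t := hfin.toFinset)
    (m := 1) (n := 2) (fun x e => G.IsLink e x.1 x.2) ?_ ?_
  · rw [mul_one, ← Set.ncard_eq_toFinset_card _ hfin, mul_comm] at h
    exact h
  · rintro ⟨u, v⟩ huv
    obtain ⟨hu, hv, -, e, he⟩ := Rel.mem_interedges_iff.1 huv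
    exact Finset.card_pos.2 ⟨e, Finset.mem_filter.2
      ⟨hfin.mem_toFinset.2 ⟨u, Finset.mem_coe.2 hu, v, Finset.mem_coe.2 hv, he⟩, he⟩⟩
  · intro e he
    obtain ⟨u, -, v, -, he⟩ := hfin.mem_toFinset.1 he
    refine (Finset.card_le_card (t := {(u, v), (v, u)}) ?_).trans Finset.card_le_two
    rintro ⟨x, y⟩ hxy
    have h1 := (Finset.mem_filter.1 hxy).2
    rw [Finset.mem_insert, Finset.mem_singleton, Prod.mk.injEq, Prod.mk.injEq]
    simpa [Subtype.ext_iff] using h1.eq_and_eq_or_eq_and_eq he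

lemma two_mul_ncard_le_adjPairs [Fintype V(G)] (hE : E(G).Finite)
    (hloop : ∀ e x, ¬ G.IsLink e x x)
    (hpar : ∀ e f x y, G.IsLink e x y → G.IsLink f x y → e = f) :
    2 * E(G).ncard ≤ adjPairs G.simpleGraph Finset.univ := by
  have h := Finset.card_mul_le_card_mul (s := hE.toFinset)
    (t := G.simpleGraph.interedges Finset.univ Finset.univ)
    (m := 2) (n := 1) (fun e x => G.IsLink e x.1 x.2) ?_ ?_
  · rw [mul_one, ← Set.ncard_eq_toFinset_card _ hE, mul_comm] at h
    exact h
  · intro e he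
    obtain ⟨x, y, hxy⟩ := Graph.exists_isLink_of_mem_edgeSet (hE.mem_toFinset.1 he)
    have hne : x ≠ y := by
      rintro rfl
      exact hloop e x hxy
    let u : V(G) := ⟨x, hxy.left_mem⟩
    let v : V(G) := ⟨y, hxy.right_mem⟩
    have huv : u ≠ v := fun h => hne (congrArg Subtype.val h)
    rw [← Finset.card_pair (show (u, v) ≠ (v, u) from fun h => huv (congrArg Prod.fst h))]
    apply Finset.card_le_card
    intro z hz
    rw [Finset.mem_insert, Finset.mem_singleton] at hz
    rcases hz with rfl | rfl
    · exact Finset.mem_filter.2 ⟨Rel.mem_interedges_iff.2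
        ⟨Finset.mem_univ _, Finset.mem_univ _, huv, e, hxy⟩, hxy⟩
    · exact Finset.mem_filter.2 ⟨Rel.mem_interedges_iff.2
        ⟨Finset.mem_univ _, Finset.mem_univ _, huv.symm, e, hxy.symm⟩, hxy.symm⟩
  · intro x _
    refine Finset.card_le_one.2 fun e he f hf => ?_
    exact hpar e f _ _ (Finset.mem_filter.1 he).2 (Finset.mem_filter.1 hf).2

/-- The sparsity condition on a set of edges, in terms of a set of vertices that contains all ends. -/
lemma two_mul_ncard_add_le {P U : Finset V(G)} (hP : ∀ v, v ∈ P ↔ (v : α) ∈ X) {F : Set β}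
    (hF : (F.ncard : ℤ) ≤ 2 * ((G.incidentVertices F \ X).ncard : ℤ) - 3 + pinBonus G X F)
    (hFU : F ⊆ G.inducedEdges U) : 2 * F.ncard + (4 * (U ∩ P).card - 6) + 6 ≤ 4 * U.card := by
  have hsub : G.incidentVertices F ⊆ Subtype.val '' (U : Set V(G)) := by
    rintro x ⟨e, he, hx⟩
    obtain ⟨u, hu, v, hv, huv⟩ := hFU he
    rcases hx.eq_or_eq_of_isLink huv with rfl | rfl
    · exact ⟨u, hu, rfl⟩
    · exact ⟨v, hv, rfl⟩
  have h1 : (G.incidentVertices F \ X).ncard ≤ (U \ P).card := by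
    rw [← Set.ncard_coe_finset, ← Set.ncard_image_of_injective _ Subtype.val_injective]
    refine Set.ncard_le_ncard ?_ ((Finset.finite_toSet _).image _)
    rintro x ⟨hx, hxX⟩
    obtain ⟨u, hu, rfl⟩ := hsub hx
    exact ⟨u, Finset.mem_coe.2 (Finset.mem_sdiff.2 ⟨hu, fun h => hxX ((hP u).1 h)⟩), rfl⟩
  have h2 : (X ∩ G.incidentVertices F).ncard ≤ (U ∩ P).card := by
    rw [← Set.ncard_coe_finset, ← Set.ncard_image_of_injective _ Subtype.val_injective]
    refine Set.ncard_le_ncard ?_ ((Finset.finite_toSet _).image _)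
    rintro x ⟨hxX, hx⟩
    obtain ⟨u, hu, rfl⟩ := hsub hx
    exact ⟨u, Finset.mem_coe.2 (Finset.mem_inter.2 ⟨hu, (hP u).2 hxX⟩), rfl⟩
  have h3 := Finset.card_sdiff_add_card_inter U P
  -- The claim is twice the bound 2|U ∖ P| - 3 + f, with f the value 0, 2 or 3 for the pins in U.
  -- Enlarging V(F) to U only weakens the bound, as f is nondecreasing in the number of pins.
  unfold pinBonus at hF
  split_ifs at hF <;> omega

/-- Rigidity does not depend on the homogeneous coordinates, so the vectors found by induction can
be exchanged for the chosen representatives of their points. -/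
lemma JointsFixed.smul {V : Type*} {H : SimpleGraph V} {X S : Set V} {q q' : V → Fin 3 → ℝ}
    (h : JointsFixed H X S q) (c : V → ℝˣ) (hq : ∀ v, c v • q v = q' v) :
    JointsFixed H X S q' := by
  have hcross : ∀ (m : Fin 3 → ℝ) v, m ⨯₃ q' v = 0 ↔ m ⨯₃ q v = 0 := fun m v => by
    rw [← hq, Units.smul_def, map_smul, smul_eq_zero_iff_right (c v).ne_zero]
  intro m h1 h2 v hv
  rw [hcross]
  refine h m (fun x y hxy => ?_) (fun x hx => (hcross _ _).1 (h2 x hx)) v hv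
  have h3 := h1 x y hxy
  rw [← hq, ← hq, Units.smul_def, Units.smul_def, map_smul, LinearMap.map_smul₂, dotProduct_smul,
    dotProduct_smul, smul_eq_zero_iff_right (c y).ne_zero,
    smul_eq_zero_iff_right (c x).ne_zero] at h3
  exact h3

lemma JointsFixed.isPinnedInfRigid [Finite V(G)] {p : V(G) → RealProjectivePlane} {P : Set V(G)}
    (hP : ∀ v, v ∈ P ↔ (v : α) ∈ X)
    (h : JointsFixed G.simpleGraph P Set.univ fun v => (p v).rep) : IsPinnedInfRigid G X p := by
  intro m hm
  rw [mem_span_trivialDangling_iff]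
  intro v
  refine exists_smul_of_cross_eq_zero (p v).rep_nonzero (h m ?_ ?_ v trivial)
  · rintro u v ⟨-, e, he⟩
    exact hm.bar e u v he
  · exact fun x hx => forall_dotProduct_barCoord_eq_zero_iff.1 (hm.pin x ((hP x).1 hx))

/-- Sufficiency of the sparsity condition. -/
theorem exists_isMinPinnedInfRigid (hV : V(G).Finite) (hE : E(G).Finite) (hX : X ⊆ V(G))
    (pX : X → RealProjectivePlane) (hpX : Function.Injective pX)
    (hcard : E(G).ncard = 2 * (V(G) \ X).ncard)
    (hsparse : ∀ F : Set β, F ⊆ E(G) → F.Nonempty →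
      (F.ncard : ℤ) ≤ 2 * ((G.incidentVertices F \ X).ncard : ℤ) - 3 + pinBonus G X F) :
    ∃ p : V(G) → RealProjectivePlane, Function.Injective p ∧
      (∀ x : X, p (Set.inclusion hX x) = pX x) ∧ IsMinPinnedInfRigid G X p := by
  have := hV.to_subtype
  have := Fintype.ofFinite V(G)
  let P : Finset V(G) := Finset.univ.filter fun v => (v : α) ∈ X
  have hP : ∀ v, v ∈ P ↔ (v : α) ∈ X := fun v => by simp [P]
  have hFU : ∀ {F : Set β} {U : Finset V(G)}, F.Nonempty → F ⊆ G.inducedEdges U →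
      2 * F.ncard + (4 * (U ∩ P).card - 6) + 6 ≤ 4 * U.card := fun hne hFU =>
    two_mul_ncard_add_le hP (hsparse _ (hFU.trans (G.inducedEdges_subset _)) hne) hFU
  have hloop : ∀ e x, ¬ G.IsLink e x x := by
    intro e x he
    let u : V(G) := ⟨x, he.left_mem⟩
    have h1 := hFU (F := {e}) (U := {u}) (Set.singleton_nonempty e) (by
      rintro _ rfl
      exact ⟨u, by simp, u, by simp, he⟩)
    rw [Set.ncard_singleton, Finset.card_singleton] at h1
    omega
  have hpar : ∀ e f x y, G.IsLink e x y → G.IsLink f x y → e = f := by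
    intro e f x y he hf
    by_contra hef
    let u : V(G) := ⟨x, he.left_mem⟩
    let v : V(G) := ⟨y, he.right_mem⟩
    have h1 := hFU (F := {e, f}) (U := {u, v}) (Set.insert_nonempty e {f}) (by
      rintro _ (rfl | rfl)
      · exact ⟨u, by simp, v, by simp, he⟩
      · exact ⟨u, by simp, v, by simp, hf⟩)
    have h2 : ({u, v} : Finset V(G)).card ≤ 2 := Finset.card_le_two
    rw [Set.ncard_pair hef] at h1
    omega
  have hH : PinnedSparse G.simpleGraph P := by
    intro U hU
    have h1 := adjPairs_le_two_mul_ncard hE U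
    have h2 : (U ∩ P).card ≤ U.card := Finset.card_le_card Finset.inter_subset_left
    unfold pinnedWeight
    -- The hypothesis is silent on empty F; without induced edges the pin term alone satisfies the
    -- bound.
    rcases (G.inducedEdges (U : Set V(G))).eq_empty_or_nonempty with h | h
    · rw [h, Set.ncard_empty] at h1
      omega
    · have := hFU h subset_rfl
      omega
  have hfree : (Finset.univ \ P).card = (V(G) \ X).ncard := by
    rw [← card_freeJoints, Nat.card_coe_set_eq, ← Set.ncard_coe_finset]
    congr 1
    ext v
    simp [hP, mem_freeJoints]
  have hS : adjPairs G.simpleGraph Finset.univ = 4 * (Finset.univ \ P).card := by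
    have h1 := two_mul_ncard_le_adjPairs hE hloop hpar
    have h2 := adjPairs_le_two_mul_ncard hE (Finset.univ : Finset V(G))
    have h3 := Set.ncard_le_ncard (G.inducedEdges_subset ((Finset.univ : Finset V(G)) : Set V(G))) hE
    omega
  let q₀ : V(G) → Fin 3 → ℝ := fun v => if h : (v : α) ∈ X then (pX ⟨v, h⟩).rep else 0
  have hq₀ : ∀ x ∈ P, ∃ h : (x : α) ∈ X, q₀ x = (pX ⟨x, h⟩).rep := fun x hx =>
    ⟨(hP x).1 hx, dif_pos ((hP x).1 hx)⟩
  obtain ⟨q, hqX, hgen, hfix⟩ := hH.exists_jointsFixed (q₀ := q₀) (S := Finset.univ)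
    (fun x hx => by
      obtain ⟨h, h'⟩ := hq₀ x hx
      rw [h']
      exact (pX _).rep_nonzero)
    (fun x hx y hy hxy => by
      obtain ⟨h1, h1'⟩ := hq₀ x hx
      obtain ⟨h2, h2'⟩ := hq₀ y hy
      rw [h1', h2', crossProduct_ne_zero_iff_linearIndependent,
        Projectivization.linearIndependent_pair_iff_ne]
      exact fun h => hxy (Subtype.ext (Subtype.mk.inj (hpX h))))
    (Finset.subset_univ P) (fun x _ _ => Finset.mem_univ x) hS
  have hq : ∀ v, q v ≠ 0 := fun v => hgen.ne_zero v (Finset.mem_univ v)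
  refine ⟨fun v => Projectivization.mk ℝ (q v) (hq v), fun u v huv => ?_, fun x => ?_, ?_⟩
  · by_contra hne
    obtain ⟨c, hc⟩ := (Projectivization.mk_eq_mk_iff' ℝ _ _ (hq u) (hq v)).1 huv
    apply hgen.cross_ne_zero u (Finset.mem_univ u) v (Finset.mem_univ v) hne
    rw [← hc, map_smul, LinearMap.smul_apply, cross_self, smul_zero]
  · have hx : Set.inclusion hX x ∈ P := (hP _).2 x.2
    obtain ⟨h, h'⟩ := hq₀ _ hx
    have hqx : q (Set.inclusion hX x) = (pX x).rep := (hqX _ hx).trans h'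
    simp only [hqx, Projectivization.mk_rep]
  · choose c hc using fun v => Projectivization.exists_smul_eq_mk_rep ℝ (q v) (hq v)
    rw [Finset.coe_univ] at hfix
    have hrigid := JointsFixed.isPinnedInfRigid (X := X) (P := (P : Set V(G)))
      (fun v => Finset.mem_coe.trans (hP v)) (hfix.smul c hc)
    exact hrigid.isMinPinnedInfRigid hV hE hcard

end Sufficiency

theorem mainTheorem9 {α β : Type*} (G : Graph α β) (hV : V(G).Finite) (hE : E(G).Finite)
    (X : Set α) (hX : X ⊆ V(G)) (pX : X → RealProjectivePlane) (hpX : Function.Injective pX) :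
    (∃ p : V(G) → RealProjectivePlane, Function.Injective p ∧
        (∀ x : X, p (Set.inclusion hX x) = pX x) ∧ IsMinPinnedInfRigid G X p) ↔
      E(G).ncard = 2 * (V(G) \ X).ncard ∧
        ∀ F : Set β, F ⊆ E(G) → F.Nonempty →
          (F.ncard : ℤ) ≤ 2 * ((G.incidentVertices F \ X).ncard : ℤ) - 3 + pinBonus G X F := by
  constructor
  · rintro ⟨p, -, -, hp⟩
    exact ⟨hp.ncard_eq hV hE, fun F hF hne => hp.ncard_le hV hE hF hne⟩
  · rintro ⟨hcard, hsparse⟩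
    exact exists_isMinPinnedInfRigid hV hE hX pX hpX hcard hsparse
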